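/- Let $p$ be a prime, let $q$ be a power $p^k$ with $k\ge 1$, and let $C$ be an algebraically closed field of characteristic $p$ which is complete with respect to a non-archimedean absolute value $|\cdot|$ (so $\mathbb F_q\subset C$). Put $v(z)=-\log|z|$ for $z\ne 0$, $v(0)=+\infty$, and $\alpha+\Delta_r=\{z\in C:|z-\alpha|\le r\}$. Let $E=\{mp^n: m,n\in\mathbb Z,\ m\ge 0\}$, and for $e=mp^n\in E$ and $z\in C$ let $z^e=\sigma^n(z)^m$, where $\sigma(z)=z^p$ is the (bijective) Frobenius map of $C$. Let $\mathcal P$ be the set of series $f=\sum_{e\in E}a_ez^e$ with $a_e\in C$ which converge at every $z\in C$ (that is, for all $z$ and all $\varepsilon>0$ only finitely many terms have absolute value greater than $\varepsilon$), and let $\mathcal F\subset\mathcal P$ be the set of those series in which only exponents $q^n$, $n\in\mathbb Z$, occur. For $n\ge 0$ let $f_n=\sum_{v_p(e)\ge -n}a_ez^e$, so that $(f_n-c)^{p^n}$ is an ordinary everywhere convergent power series for each $c \in C$. The Newton polygon of a series $\sum a_ez^e$ in $\mathcal P$ is the lower convex hull of the points $(e,v(a_e))$, $a_e\neq0$. Theorem.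 Suppose $f=\sum a_e z^e\in\mathcal P$ is not constant, and $c\in C$. Then there is a unique Borel measure $\mu$ on $f^{-1}(c)$ such that, for all $\alpha\in C$ and $r>0$, $$\mu\bigl(f^{-1}(c)\cap(\alpha+\Delta_r)\bigr)=\lim_{n\to\infty}\frac{\#\{\text{zeros of }(f_n-c)^{p^n}\text{ in }\alpha+\Delta_r\}}{p^n},$$ zeros being counted with multiplicity (in particular, the limit exists). It has the following properties. 1. For every real $s$, the horizontal length of the segment of slope $s$ of the Newton polygon of $f-c$ (taken to be $0$ if there is no such segment) equals $\mu(\{z\in f^{-1}(c): v(z)=-s\})$. 2. $\mu(f^{-1}(c))=\sup\{e: a_e\ne 0\}$ (both may be $+\infty$). 3. If $f\in C[[z]]$, then $\mu$ is the counting measure with multiplicities: $\mu(S)=\sum_{x\in S}m(x)$ for every $S\subseteq f^{-1}(c)$, where $m(x)$ is the multiplicity of $x$ as a zero of $f-c$; in particular $\mu(\{x\})=m(x)$. 4. If $f\in\mathcal F$ and $c=0$, then $\ker f=f^{-1}(0)$ is a locally compact group and $\mu$ is a Haar measure on it. -/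

import Mathlib

open Filter Topology MeasureTheory
open scoped ENNReal

noncomputable section

namespace FracSeries

/-- The exponent monoid `E = { m p ^ n : m, n ∈ ℤ, m ≥ 0 }`, as a set of rational numbers. -/
def Exponent (p : ℕ) : Type :=
  {e : ℚ // ∃ (m : ℕ) (n : ℤ), e = (m : ℚ) * (p : ℚ) ^ n}

namespace Exponent

variable {p : ℕ}

/-- The rational number underlying an exponent. -/
def val (e : Exponent p) : ℚ := Subtype.val e

/-- A natural number as an exponent. -/
def ofNat (p m : ℕ) : Exponent p := ⟨m, m, 0, by simp⟩

/-- The exponent `e / p ^ n`. -/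
def divPow [hp : Fact p.Prime] (e : Exponent p) (n : ℕ) : Exponent p :=
  ⟨e.val / (p : ℚ) ^ n, by
    obtain ⟨m, k, h⟩ := e.2
    have hp0 : (p : ℚ) ≠ 0 := by exact_mod_cast hp.out.ne_zero
    refine ⟨m, k - n, ?_⟩
    rw [zpow_sub₀ hp0, zpow_natCast, val, h, mul_div_assoc]⟩

end Exponent

section Series

variable (p : ℕ) {C : Type*}

/-- `z ^ e = (z ^ (1 / p ^ n)) ^ m` for `e = m / p ^ n` in lowest terms; see `fracPow_pow_eq` for
its compatibility with every other way of writing `e`. -/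
def fracPow [Field C] [Fact p.Prime] [CharP C p] [PerfectRing C p]
    (z : C) (e : Exponent p) : C :=
  ((frobeniusEquiv C p).symm^[padicValNat p e.val.den] z) ^ e.val.num.toNat

/-- A family `a` of coefficients stands for the formal series `∑_{e ∈ E} a_e z ^ e`.
The series is everywhere convergent if at each `z` its (countably many) terms tend to `0`: for each
`r > 0` only finitely many of them are of absolute value greater than `r`. -/
def EverywhereConvergent [NormedField C] [Fact p.Prime] [CharP C p] [PerfectRing C p]
    (a : Exponent p → C) : Prop :=
  ∀ z : C, Tendsto (fun e => a e * fracPow p z e) cofinite (𝓝 0)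

/-- The set `𝓟` of everywhere convergent fractional power series. -/
def seriesP (C : Type*) [NormedField C] [Fact p.Prime] [CharP C p] [PerfectRing C p] :
    Set (Exponent p → C) :=
  {a | EverywhereConvergent p a}

/-- The set `𝓕` of everywhere convergent `𝔽_q`-linear series `∑_{n ∈ ℤ} a_n z ^ (q ^ n)`, where
`q = p ^ k`. -/
def seriesF (k : ℕ) (C : Type*) [NormedField C] [Fact p.Prime] [CharP C p] [PerfectRing C p] :
    Set (Exponent p → C) :=
  {a | a ∈ seriesP p C ∧ ∀ e, a e ≠ 0 → ∃ n : ℤ, e.val = ((p : ℚ) ^ k) ^ n}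

/-- The function on `C` defined by a series. -/
def eval [NormedField C] [Fact p.Prime] [CharP C p] [PerfectRing C p]
    (a : Exponent p → C) (z : C) : C :=
  ∑' e, a e * fracPow p z e

/-- The fibre `f⁻¹(c)`. -/
def fiber [NormedField C] [Fact p.Prime] [CharP C p] [PerfectRing C p]
    (a : Exponent p → C) (c : C) : Set C :=
  {z | eval p a z = c}

open scoped Classical in
/-- The constant series `c`. -/
def const [Zero C] (c : C) : Exponent p → C :=
  fun e => if e.val = 0 then c else 0

/-- A series is constant if all coefficients at nonzero exponents vanish. -/
def IsConstant [Zero C] (a : Exponent p → C) : Prop :=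
  ∀ e, e.val ≠ 0 → a e = 0

/-- An ordinary power series: only natural numbers occur as exponents. -/
def IsOrdinary [Zero C] (a : Exponent p → C) : Prop :=
  ∀ e, a e ≠ 0 → ∃ m : ℕ, e.val = m

open scoped Classical in
/-- `f_n`, the sum of the terms `a_e z ^ e` of `f` with `v_p(e) ≥ -n` (and `v_p(0) = ∞`). -/
def trunc [Zero C] (n : ℕ) (a : Exponent p → C) : Exponent p → C :=
  fun e => if e.val = 0 ∨ -(n : ℤ) ≤ padicValRat p e.val then a e else 0

/-- `g ^ (p ^ n) = ∑ b_e ^ (p ^ n) z ^ (e p ^ n)` for `g = ∑ b_e z ^ e`, in characteristic `p`. -/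
def frobPow [Monoid C] [Fact p.Prime] (n : ℕ) (b : Exponent p → C) : Exponent p → C :=
  fun e => b (e.divPow n) ^ p ^ n

/-- The power series with the coefficients of `b` at the natural numbers; it is `b` itself if `b` is
ordinary. -/
def toPowerSeries [Semiring C] (b : Exponent p → C) : PowerSeries C :=
  PowerSeries.mk fun m => b (Exponent.ofNat p m)

end Series

section Zeros

variable {C : Type*} [NormedField C]

/-- The expansion at `x` of an everywhere convergent power series `g = ∑ b_k z ^ k`, that is,
`g (x + z) = ∑_m (∑_k (k + m choose m) b_{k + m} x ^ k) z ^ m`. -/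
def expandAt (g : PowerSeries C) (x : C) : PowerSeries C :=
  PowerSeries.mk fun m =>
    ∑' k : ℕ, ((k + m).choose m : C) * PowerSeries.coeff (k + m) g * x ^ k

/-- The multiplicity of `x` as a zero of an everywhere convergent power series `g`
(`0` if `g x ≠ 0`, and `⊤` if `g = 0`). -/
def zeroMultiplicity (g : PowerSeries C) (x : C) : ℕ∞ :=
  (expandAt g x).order

/-- The number of zeros of `g` in `S`, counted with multiplicity. -/
def numZeros (g : PowerSeries C) (S : Set C) : ℝ≥0∞ :=
  ∑' x : S, (zeroMultiplicity g (x : C) : ℝ≥0∞)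

open scoped Classical in
/-- The additive valuation `v z = -log |z|`, with `v 0 = +∞`. -/
def valuation (z : C) : EReal :=
  if z = 0 then ⊤ else ((-Real.log ‖z‖ : ℝ) : EReal)

end Zeros

section Newton

variable (p : ℕ) {C : Type*} [NormedField C]

/-- The points `(e, v(a_e))` of the plane (there is none at `e` if `v(a_e) = +∞`). -/
def newtonPoints (a : Exponent p → C) : Set (ℝ × ℝ) :=
  {P | ∃ e : Exponent p, P.1 = (e.val : ℝ) ∧ valuation (a e) = (P.2 : EReal)}

/-- The Newton polygon, that is, the lower boundary of the convex hull of the points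
`(e, v(a_e))`. -/
def newtonPolygon (a : Exponent p → C) : Set (ℝ × ℝ) :=
  {P | P ∈ convexHull ℝ (newtonPoints p a) ∧
    ∀ y : ℝ, (P.1, y) ∈ convexHull ℝ (newtonPoints p a) → P.2 ≤ y}

/-- The set of points of contact of the Newton polygon with its supporting line of slope `s`: the
segment of slope `s` if there is one, and a single vertex otherwise. -/
def newtonSegment (a : Exponent p → C) (s : ℝ) : Set (ℝ × ℝ) :=
  {P | P ∈ newtonPolygon p a ∧ ∀ Q ∈ newtonPolygon p a, P.2 - s * P.1 ≤ Q.2 - s * Q.1}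

/-- The horizontal length of the segment of slope `s` of the Newton polygon (`0` if there is no such
segment). -/
def segmentLength (a : Exponent p → C) (s : ℝ) : ℝ≥0∞ :=
  Metric.ediam (Prod.fst '' newtonSegment p a s)

end Newton

section Facts

variable {p : ℕ} {C : Type*}

theorem Exponent.den_eq [hp : Fact p.Prime] (e : Exponent p) :
    e.val.den = p ^ padicValNat p e.val.den := by
  obtain ⟨m, n, h⟩ := e.2
  have hp0 : (p : ℚ) ≠ 0 := by exact_mod_cast hp.out.ne_zero
  have hd : e.val.den ∣ p ^ n.natAbs := by
    have h1 : e.val = Rat.divInt (m * p ^ n.toNat : ℕ) (p ^ (-n).toNat : ℕ) := by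
      rw [Rat.divInt_eq_div, val, h]
      push_cast
      rw [eq_div_iff (pow_ne_zero _ hp0), mul_assoc, ← zpow_natCast, ← zpow_natCast,
        ← zpow_add₀ hp0]
      congr 2
      omega
    have h2 := Rat.den_dvd (m * p ^ n.toNat : ℕ) (p ^ (-n).toNat : ℕ)
    rw [← h1] at h2
    exact (Int.natCast_dvd_natCast.mp h2).trans (pow_dvd_pow _ (by omega))
  obtain ⟨j, -, hj⟩ := (Nat.dvd_prime_pow hp.out).mp hd
  rw [hj, padicValNat.prime_pow]

theorem Exponent.val_nonneg (e : Exponent p) : 0 ≤ e.val := by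
  obtain ⟨m, n, h⟩ := e.2
  rw [val, h]
  positivity

theorem fracPow_pow_eq [Field C] [hp : Fact p.Prime] [CharP C p] [PerfectRing C p]
    (z : C) (e : Exponent p) (m n : ℕ) (h : e.val * (p : ℚ) ^ n = m) :
    fracPow p z e ^ p ^ n = z ^ m := by
  set d := padicValNat p e.val.den with hd
  have hden := e.den_eq
  rw [← hd] at hden
  have hnum : ((e.val.num.toNat : ℕ) : ℚ) = e.val * (p : ℚ) ^ d := by
    have h1 : ((e.val.num.toNat : ℕ) : ℤ) = e.val.num :=
      Int.toNat_of_nonneg (Rat.num_nonneg.mpr e.val_nonneg)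
    have h2 : ((e.val.num.toNat : ℕ) : ℚ) = (e.val.num : ℚ) := by exact_mod_cast h1
    rw [h2]
    have h3 : (p : ℚ) ^ d = (e.val.den : ℚ) := by rw [hden]; push_cast; rfl
    rw [h3, Rat.mul_den_eq_num]
  have hm : e.val.num.toNat * p ^ n = m * p ^ d := by
    have : ((e.val.num.toNat * p ^ n : ℕ) : ℚ) = ((m * p ^ d : ℕ) : ℚ) := by
      push_cast
      rw [hnum, ← h]
      ring
    exact_mod_cast this
  have key : ((frobeniusEquiv C p).symm^[d] z) ^ p ^ d = z :=
    iterate_frobeniusEquiv_symm_pow_p_pow C p z d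
  rw [fracPow, ← hd, ← pow_mul, hm, mul_comm m, pow_mul, key]

theorem summable_of_mem [NormedField C] [IsUltrametricDist C] [CompleteSpace C] [Fact p.Prime]
    [CharP C p] [PerfectRing C p] {a : Exponent p → C} (ha : a ∈ seriesP p C) (z : C) :
    Summable fun e => a e * fracPow p z e :=
  NonarchimedeanAddGroup.summable_of_tendsto_cofinite_zero (ha z)

theorem fracPow_add [Field C] [hp : Fact p.Prime] [CharP C p] [PerfectRing C p]
    (x y : C) (e : Exponent p) (n : ℤ) (h : e.val = (p : ℚ) ^ n) :
    fracPow p (x + y) e = fracPow p x e + fracPow p y e := by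
  have hp0 : (p : ℚ) ≠ 0 := by exact_mod_cast hp.out.ne_zero
  have h1 : e.val * (p : ℚ) ^ (-n).toNat = ((p ^ n.toNat : ℕ) : ℚ) := by
    rw [h]
    push_cast
    rw [← zpow_natCast, ← zpow_natCast, ← zpow_add₀ hp0]
    congr 1
    omega
  apply iterateFrobenius_inj C p (-n).toNat
  rw [map_add]
  simp only [iterateFrobenius_def]
  rw [fracPow_pow_eq _ _ _ _ h1, fracPow_pow_eq _ _ _ _ h1, fracPow_pow_eq _ _ _ _ h1,
    add_pow_char_pow]

theorem eval_add [NormedField C] [IsUltrametricDist C] [CompleteSpace C] [Fact p.Prime]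
    [CharP C p] [PerfectRing C p] {k : ℕ} {a : Exponent p → C} (ha : a ∈ seriesF p k C)
    (x y : C) : eval p a (x + y) = eval p a x + eval p a y := by
  rw [eval, eval, eval, ← (summable_of_mem ha.1 x).tsum_add (summable_of_mem ha.1 y)]
  refine tsum_congr fun e => ?_
  by_cases he : a e = 0
  · simp [he]
  · obtain ⟨n, hn⟩ := ha.2 e he
    rw [fracPow_add x y e (k * n) (by rw [hn, zpow_mul, zpow_natCast]), mul_add]

/-- The kernel of an element of `𝓕`, as an additive subgroup of `C`. -/
def ker [NormedField C] [IsUltrametricDist C] [CompleteSpace C] [Fact p.Prime]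
    [CharP C p] [PerfectRing C p] {k : ℕ} (a : Exponent p → C) (ha : a ∈ seriesF p k C) :
    AddSubgroup C :=
  (AddMonoidHom.mk' (eval p a) (eval_add ha)).ker

theorem coe_ker [NormedField C] [IsUltrametricDist C] [CompleteSpace C] [Fact p.Prime]
    [CharP C p] [PerfectRing C p] {k : ℕ} (a : Exponent p → C) (ha : a ∈ seriesF p k C) :
    (ker a ha : Set C) = fiber p a 0 := by
  ext z
  exact AddMonoidHom.mem_ker

/-- The tautological identification of the fibre `f⁻¹(c)`, where `c = 0`, with `ker f`. -/
def fiberToKer [NormedField C] [IsUltrametricDist C] [CompleteSpace C] [Fact p.Prime]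
    [CharP C p] [PerfectRing C p] {k : ℕ} {a : Exponent p → C} (ha : a ∈ seriesF p k C)
    {c : C} (hc : c = 0) : fiber p a c → ker a ha :=
  Set.inclusion (by rw [coe_ker, hc])

end Facts

end FracSeries

end

/-! Everything is read off polynomials. Over an algebraically closed ultrametric field, the number
of roots in a closed disc is the last index at which the expansion about the centre attains its
Gauss norm (`isDominant_taylor`), so it survives any perturbation smaller than that norm
(`rootCount_eq_of_coeff_sub`).

On a disc of radius `R` a series `b` in `𝓟` has only finitely many terms above a given size, so for
some `n` its `p ^ n`-th power agrees with a polynomial `Q` up to `ε ^ p ^ n` (`Approx`). Frobenius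
is additive, so `Q ^ p ^ k` is an approximation at level `n + k` with the same `ε`, and the root
count divided by `p ^ n` is unchanged. Approximations at different levels can thus be raised to a
common one; a lower bound `l ^ p ^ n` for their Gauss norms, with `l` independent of `n`
(`exists_discNorm_lower_bound`), then forces their normalised counts to agree (`exists_hasCount`).
Hence the sequence defining the measure is eventually constant on each disc.

The same bound shows that zeros of `b` and roots of `Q` are mutually close
(`exists_forall_approx_roots`). So the fibre is a proper space, and on finitely many discs the
counts are the masses of a finite sum of point masses sitting at zeros (`exists_measure_finset`). In
a proper ultrametric space the closed balls form a semiring of compact open sets, so this finite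
consistency already produces a Borel measure (`exists_measure_closedBall`).

The properties follow by computing counts. Around `0` the count is the last exponent of maximal
term, and the first such exponent governs the open disc; these are the ends of a segment of the
Newton polygon. For ordinary series, small discs count the multiplicity of their centre. For linear
series the approximations can be taken additive, and then translation by a zero changes them by a
negligible constant. -/

set_option linter.unusedSectionVars false

noncomputable section

namespace FracSeries

/-! ### Gauss norms and root counts of polynomials on discs -/

section

open Polynomial

section PolynomialRoots

variable {F : Type*} [NormedField F]

/-- `M` is the Gauss norm of `A` at radius `r`, and `K` is the last index where it is attained. -/
structure IsDominant (A : F[X]) (r M : ℝ) (K : ℕ) : Prop where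
  pos : 0 < M
  le : ∀ j, ‖A.coeff j‖ * r ^ j ≤ M
  eq : ‖A.coeff K‖ * r ^ K = M
  lt : ∀ j, K < j → ‖A.coeff j‖ * r ^ j < M

theorem IsDominant.unique {A : F[X]} {r M M' : ℝ} {K K' : ℕ} (h : IsDominant A r M K)
    (h' : IsDominant A r M' K') : M = M' ∧ K = K' := by
  have hM : M = M' := le_antisymm (h.eq ▸ h'.le K) (h'.eq ▸ h.le K')
  refine ⟨hM, le_antisymm ?_ ?_⟩ <;> by_contra! hlt
  · exact absurd h.eq (hM ▸ (h'.lt K hlt).ne)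
  · exact absurd h'.eq (hM ▸ (h.lt K' hlt).ne)

theorem IsDominant.ne_zero {A : F[X]} {r M : ℝ} {K : ℕ} (h : IsDominant A r M K) : A ≠ 0 := by
  rintro rfl
  simpa using h.eq.trans_ne h.pos.ne'

variable [IsUltrametricDist F]

theorem norm_sub_le_max' (x y : F) : ‖x - y‖ ≤ max ‖x‖ ‖y‖ := by
  simpa [sub_eq_add_neg] using IsUltrametricDist.norm_add_le_max x (-y)

theorem norm_eq_of_norm_sub_lt {x y : F} (h : ‖x - y‖ < ‖x‖) : ‖y‖ = ‖x‖ := by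
  refine le_antisymm ?_ ?_
  · have := norm_sub_le_max' x (x - y)
    rw [sub_sub_cancel] at this
    exact this.trans (max_le le_rfl h.le)
  · have := IsUltrametricDist.norm_add_le_max (x - y) y
    rw [sub_add_cancel] at this
    rcases le_max_iff.mp this with h1 | h1
    · exact absurd h h1.not_gt
    · exact h1

theorem IsDominant.of_sub_lt {A B : F[X]} {r M : ℝ} {K : ℕ} (hr : 0 ≤ r) (h : IsDominant A r M K)
    (hs : ∀ j, ‖(A - B).coeff j‖ * r ^ j < M) : IsDominant B r M K := by
  have key : ∀ j, ‖B.coeff j‖ * r ^ j ≤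
      max (‖A.coeff j‖ * r ^ j) (‖(A - B).coeff j‖ * r ^ j) := fun j => by
    rw [← max_mul_of_nonneg _ _ (by positivity)]
    gcongr
    rw [coeff_sub]
    simpa using norm_sub_le_max' (A.coeff j) (A.coeff j - B.coeff j)
  refine ⟨h.pos, fun j => (key j).trans (max_le (h.le j) (hs j).le), ?_,
    fun j hj => (key j).trans_lt (max_lt (h.lt j hj) (hs j))⟩
  have h1 := hs K
  rw [← h.eq] at h1
  rw [coeff_sub] at h1
  rw [norm_eq_of_norm_sub_lt (lt_of_mul_lt_mul_right h1 (by positivity)), h.eq]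

omit [IsUltrametricDist F] in
theorem coeff_X_sub_C_mul_succ (A : F[X]) (y : F) (j : ℕ) :
    ((X - C y) * A).coeff (j + 1) = A.coeff j - y * A.coeff (j + 1) := by
  simp [sub_mul, coeff_X_mul]

omit [IsUltrametricDist F] in
theorem norm_coeff_X_sub_C_mul_zero (A : F[X]) (y : F) (r : ℝ) :
    ‖((X - C y) * A).coeff 0‖ * r ^ 0 = ‖y‖ * (‖A.coeff 0‖ * r ^ 0) := by
  simp [sub_mul]

theorem norm_coeff_X_sub_C_mul_succ_le (A : F[X]) (y : F) {r : ℝ} (hr : 0 ≤ r) (j : ℕ) :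
    ‖((X - C y) * A).coeff (j + 1)‖ * r ^ (j + 1) ≤
      max (r * (‖A.coeff j‖ * r ^ j)) (‖y‖ * (‖A.coeff (j + 1)‖ * r ^ (j + 1))) := by
  rw [coeff_X_sub_C_mul_succ]
  refine (mul_le_mul_of_nonneg_right (norm_sub_le_max' _ _) (by positivity)).trans ?_
  rw [max_mul_of_nonneg _ _ (by positivity), norm_mul]
  apply le_of_eq
  congr 1 <;> ring

/-- At index `K + 1` the contribution of `X` has size `r * M`, while that of `y` is strictly smaller
because `K` is the last maximal index. So a root inside the disc raises the index by one. -/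
theorem IsDominant.X_sub_C_mul_of_le {A : F[X]} {r M : ℝ} {K : ℕ} (hr : 0 < r)
    (h : IsDominant A r M K) {y : F} (hy : ‖y‖ ≤ r) :
    IsDominant ((X - C y) * A) r (r * M) (K + 1) := by
  have hle : ∀ j, ‖y‖ * (‖A.coeff j‖ * r ^ j) ≤ r * (‖A.coeff j‖ * r ^ j) := fun j => by gcongr
  have hrle : ∀ j, r * (‖A.coeff j‖ * r ^ j) ≤ r * M := fun j =>
    mul_le_mul_of_nonneg_left (h.le j) hr.le
  have hrlt : ∀ j, K < j → r * (‖A.coeff j‖ * r ^ j) < r * M := fun j hj =>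
    mul_lt_mul_of_pos_left (h.lt j hj) hr
  refine ⟨mul_pos hr h.pos, fun j => ?_, ?_, fun j hj => ?_⟩
  · rcases j with _ | j
    · rw [norm_coeff_X_sub_C_mul_zero]
      exact (hle 0).trans (hrle 0)
    · exact (norm_coeff_X_sub_C_mul_succ_le A y hr.le j).trans
        (max_le (hrle j) ((hle _).trans (hrle _)))
  · rw [coeff_X_sub_C_mul_succ, norm_eq_of_norm_sub_lt (x := A.coeff K), pow_succ', ← h.eq]
    · ring
    · rw [sub_sub_cancel, norm_mul]
      have h1 := (hle (K + 1)).trans_lt (hrlt (K + 1) K.lt_succ_self)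
      rw [← h.eq] at h1
      refine lt_of_mul_lt_mul_right (a := r ^ (K + 1)) ?_ (by positivity)
      calc _ = _ := by ring
        _ < _ := h1
        _ = _ := by ring
  · obtain ⟨j, rfl⟩ : ∃ i, j = i + 1 := ⟨j - 1, by omega⟩
    exact (norm_coeff_X_sub_C_mul_succ_le A y hr.le j).trans_lt
      (max_lt (hrlt j (by omega)) ((hle _).trans_lt (hrlt _ (by omega))))

/-- Here every contribution of `X` is strictly below `‖y‖ * M`, so multiplication by the constant
`y` decides: a root outside the disc only rescales the norm. -/
theorem IsDominant.X_sub_C_mul_of_lt {A : F[X]} {r M : ℝ} {K : ℕ} (hr : 0 < r)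
    (h : IsDominant A r M K) {y : F} (hy : r < ‖y‖) :
    IsDominant ((X - C y) * A) r (‖y‖ * M) K := by
  have hy0 : 0 < ‖y‖ := hr.trans hy
  have hle : ∀ j, ‖y‖ * (‖A.coeff j‖ * r ^ j) ≤ ‖y‖ * M := fun j =>
    mul_le_mul_of_nonneg_left (h.le j) hy0.le
  have hlt : ∀ j, K < j → ‖y‖ * (‖A.coeff j‖ * r ^ j) < ‖y‖ * M := fun j hj =>
    mul_lt_mul_of_pos_left (h.lt j hj) hy0
  have hrlt : ∀ j, r * (‖A.coeff j‖ * r ^ j) < ‖y‖ * M := fun j =>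
    (mul_le_mul_of_nonneg_left (h.le j) hr.le).trans_lt (mul_lt_mul_of_pos_right hy h.pos)
  refine ⟨mul_pos hy0 h.pos, fun j => ?_, ?_, fun j hj => ?_⟩
  · rcases j with _ | j
    · rw [norm_coeff_X_sub_C_mul_zero]
      exact hle 0
    · exact (norm_coeff_X_sub_C_mul_succ_le A y hr.le j).trans (max_le (hrlt j).le (hle _))
  · rcases K with _ | K
    · rw [norm_coeff_X_sub_C_mul_zero, h.eq]
    · rw [coeff_X_sub_C_mul_succ, ← norm_neg, neg_sub,
        norm_eq_of_norm_sub_lt (x := y * A.coeff (K + 1)), norm_mul, mul_assoc, h.eq]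
      rw [sub_sub_cancel, norm_mul]
      have h1 := hrlt K
      rw [← h.eq] at h1
      refine lt_of_mul_lt_mul_right (a := r ^ (K + 1)) ?_ (by positivity)
      calc _ = _ := by ring
        _ < _ := h1
        _ = _ := by ring
  · obtain ⟨j, rfl⟩ : ∃ i, j = i + 1 := ⟨j - 1, by omega⟩
    exact (norm_coeff_X_sub_C_mul_succ_le A y hr.le j).trans_lt
      (max_lt (hrlt j) (hlt _ (by omega)))

open scoped Classical in
/-- The number of roots of `Q` in a closed disc, counted with multiplicity. -/
def rootCount (Q : F[X]) (α : F) (r : ℝ) : ℕ :=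
  Q.roots.countP (· ∈ Metric.closedBall α r)

/-- The Gauss norm of a split polynomial `Q` on a closed disc, in terms of its roots. -/
def discNorm (Q : F[X]) (α : F) (r : ℝ) : ℝ :=
  ‖Q.leadingCoeff‖ * (Q.roots.map fun y => max r ‖y - α‖).prod

/-- Induction on the roots, each factor being recentred at `α` and handled by one of the two
preceding lemmas. -/
theorem isDominant_prod (α : F) {r : ℝ} (hr : 0 < r) (c : F) (hc : c ≠ 0) (s : Multiset F) :
    open scoped Classical in
    IsDominant (taylor α (C c * (s.map fun y => X - C y).prod)) r
      (‖c‖ * (s.map fun y => max r ‖y - α‖).prod) (s.countP (· ∈ Metric.closedBall α r)) := by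
  classical
  induction s using Multiset.induction_on with
  | empty =>
    refine ⟨by simpa using hc, fun j => ?_, by simp, fun j hj => ?_⟩
    · rcases j with _ | j <;> simp [coeff_C_succ]
    · obtain ⟨j, rfl⟩ : ∃ i, j = i + 1 := ⟨j - 1, by simp at hj; omega⟩
      simpa [coeff_C_succ] using hc
  | cons y s ih =>
    have e1 : taylor α (C c * ((y ::ₘ s).map fun y => X - C y).prod) =
        (X - C (y - α)) * taylor α (C c * (s.map fun y => X - C y).prod) := by
      rw [Multiset.map_cons, Multiset.prod_cons, mul_left_comm, taylor_mul]
      congr 1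
      simp [map_sub]
      ring
    rw [e1, Multiset.map_cons, Multiset.prod_cons, mul_left_comm]
    by_cases hy : ‖y - α‖ ≤ r
    · rw [max_eq_left hy, Multiset.countP_cons_of_pos _ (by simpa [dist_eq_norm] using hy)]
      exact ih.X_sub_C_mul_of_le hr hy
    · rw [max_eq_right (not_le.mp hy).le,
        Multiset.countP_cons_of_neg _ (by simpa [dist_eq_norm] using hy)]
      exact ih.X_sub_C_mul_of_lt hr (not_le.mp hy)

variable [IsAlgClosed F]

theorem isDominant_taylor {Q : F[X]} (hQ : Q ≠ 0) (α : F) {r : ℝ} (hr : 0 < r) :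
    IsDominant (taylor α Q) r (discNorm Q α r) (rootCount Q α r) := by
  have h := isDominant_prod α hr Q.leadingCoeff (leadingCoeff_ne_zero.mpr hQ) Q.roots
  rwa [← (IsAlgClosed.splits Q).eq_prod_roots] at h

omit [IsAlgClosed F] [IsUltrametricDist F] in
theorem discNorm_mono (Q : F[X]) (α : F) {r s : ℝ} (hr : 0 ≤ r) (hrs : r ≤ s) :
    discNorm Q α r ≤ discNorm Q α s := by
  unfold discNorm
  gcongr
  refine Multiset.prod_map_le_prod_map₀ _ _ (fun y _ => le_max_of_le_left hr) fun y _ => ?_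
  gcongr

-- By the ultrametric inequality `max r ‖y - α‖` depends only on the disc and not on the chosen
-- centre.
omit [IsAlgClosed F] in
theorem discNorm_recenter (Q : F[X]) {α β : F} {r : ℝ} (h : ‖α - β‖ ≤ r) :
    discNorm Q α r = discNorm Q β r := by
  unfold discNorm
  congr 3
  ext y
  have h1 := IsUltrametricDist.norm_add_le_max (y - α) (α - β)
  have h2 := norm_sub_le_max' (y - β) (α - β)
  rw [sub_add_sub_cancel] at h1
  rw [sub_sub_sub_cancel_right] at h2
  apply le_antisymm
  · exact max_le (le_max_left _ _) (h2.trans (max_le (le_max_right _ _) (le_max_of_le_left h)))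
  · exact max_le (le_max_left _ _) (h1.trans (max_le (le_max_right _ _) (le_max_of_le_left h)))

omit [IsAlgClosed F] in
theorem rootCount_recenter (Q : F[X]) {α β : F} {r : ℝ} (h : ‖α - β‖ ≤ r) :
    rootCount Q α r = rootCount Q β r := by
  unfold rootCount
  rw [IsUltrametricDist.closedBall_eq_of_mem (x := β) (y := α) (by simpa [dist_eq_norm] using h)]

/-- The Gauss norm does not grow on passing to a disc inside the disc of radius `R` about `0`. -/
theorem norm_coeff_taylor_le (D : F[X]) {α : F} {r R A : ℝ} (hr : 0 < r) (hrR : r ≤ R)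
    (hα : ‖α‖ ≤ R) (h : ∀ j, ‖D.coeff j‖ * R ^ j ≤ A) (j : ℕ) :
    ‖(taylor α D).coeff j‖ * r ^ j ≤ A := by
  by_cases hD : D = 0
  · simpa [hD] using h j
  refine ((isDominant_taylor hD α hr).le j).trans ((discNorm_mono D α hr.le hrR).trans ?_)
  rw [discNorm_recenter D (β := 0) (by simpa using hα)]
  have h0 := isDominant_taylor hD 0 (hr.trans_le hrR)
  rw [taylor_zero] at h0
  exact h0.eq ▸ h _

/-- A Rouché principle: a perturbation below the Gauss norm keeps the last maximal index. -/
theorem rootCount_eq_of_coeff_sub {Q Q' : F[X]} (hQ : Q ≠ 0) {α : F} {r R A : ℝ} (hr : 0 < r)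
    (hrR : r ≤ R) (hα : ‖α‖ ≤ R) (h : ∀ j, ‖(Q - Q').coeff j‖ * R ^ j ≤ A)
    (hA : A < discNorm Q α r) : rootCount Q' α r = rootCount Q α r := by
  have h1 : IsDominant (taylor α Q') r (discNorm Q α r) (rootCount Q α r) :=
    (isDominant_taylor hQ α hr).of_sub_lt hr.le fun j => by
      rw [← map_sub]
      exact (norm_coeff_taylor_le _ hr hrR hα h j).trans_lt hA
  have hQ' : Q' ≠ 0 := by
    rintro rfl
    exact h1.ne_zero (map_zero _)
  exact ((isDominant_taylor hQ' α hr).unique h1).2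

/-- The coefficient that attains the Gauss norm at radius `R` is still available at radius `r`; its
index is the root count. -/
theorem discNorm_mul_pow_le {Q : F[X]} (hQ : Q ≠ 0) (α : F) {r R : ℝ} (hr : 0 < r) (hrR : r ≤ R) :
    discNorm Q α R * (r / R) ^ rootCount Q α R ≤ discNorm Q α r := by
  have hR := hr.trans_le hrR
  refine le_trans (le_of_eq ?_) ((isDominant_taylor hQ α hr).le (rootCount Q α R))
  rw [← (isDominant_taylor hQ α hR).eq, mul_assoc, ← mul_pow, mul_div_cancel₀ _ hR.ne']

theorem discNorm_eq_norm_eval {Q : F[X]} (hQ : Q ≠ 0) {α : F} {r : ℝ} (hr : 0 < r)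
    (h : rootCount Q α r = 0) : discNorm Q α r = ‖Q.eval α‖ := by
  have := (isDominant_taylor hQ α hr).eq
  rw [h, taylor_coeff_zero] at this
  simpa using this.symm

open scoped Classical in
omit [IsUltrametricDist F] [IsAlgClosed F] in
theorem exists_root_of_rootCount_ne_zero {Q : F[X]} {α : F} {r : ℝ} (h : rootCount Q α r ≠ 0) :
    ∃ y ∈ Metric.closedBall α r, y ∈ Q.roots := by
  obtain ⟨y, hy, hy'⟩ := Multiset.countP_pos.mp (Nat.pos_of_ne_zero h)
  exact ⟨y, hy', hy⟩

open scoped Classical in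
omit [IsUltrametricDist F] [IsAlgClosed F] in
theorem rootCount_ne_zero_of_mem {Q : F[X]} {α y : F} {r : ℝ} (hy : y ∈ Q.roots)
    (h : y ∈ Metric.closedBall α r) : rootCount Q α r ≠ 0 :=
  (Multiset.countP_pos.mpr ⟨y, hy, h⟩).ne'

open scoped Classical in
omit [IsUltrametricDist F] [IsAlgClosed F] in
theorem rootCount_eq_sum (Q : F[X]) (α : F) (r : ℝ) :
    rootCount Q α r =
      ∑ y ∈ Q.roots.toFinset, if y ∈ Metric.closedBall α r then Q.roots.count y else 0 := by
  rw [rootCount, Multiset.countP_eq_card_filter, ← Multiset.toFinset_sum_count_eq,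
    Multiset.toFinset_filter, Finset.sum_filter]
  refine Finset.sum_congr rfl fun y _ => ?_
  split_ifs with h
  · rw [Multiset.count_filter_of_pos h]
  · rfl

open scoped Classical in
omit [IsUltrametricDist F] [IsAlgClosed F] in
theorem rootCount_pow (Q : F[X]) (α : F) (r : ℝ) (n : ℕ) :
    rootCount (Q ^ n) α r = n * rootCount Q α r := by
  rw [rootCount, roots_pow]
  exact Multiset.countP_nsmul ..

end PolynomialRoots

end

/-! ### Arithmetic of fractional exponents -/

section

open Polynomial

section Exponents

variable {p : ℕ} [hp : Fact p.Prime]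

theorem natCast_pow_ne_zero (p : ℕ) [hp : Fact p.Prime] (n : ℕ) : (p : ℚ) ^ n ≠ 0 :=
  pow_ne_zero _ (by exact_mod_cast hp.out.ne_zero)

namespace Exponent

@[ext] theorem ext {e e' : Exponent p} (h : e.val = e'.val) : e = e' := Subtype.ext h

theorem val_ofNat (m : ℕ) : (ofNat p m).val = m := rfl

theorem val_divPow (e : Exponent p) (n : ℕ) : (e.divPow n).val = e.val / (p : ℚ) ^ n := rfl

/-- The exponent `e * p ^ n`. -/
def mulPow (e : Exponent p) (n : ℕ) : Exponent p :=
  ⟨e.val * (p : ℚ) ^ n, by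
    obtain ⟨m, k, h⟩ := e.2
    have hp0 : (p : ℚ) ≠ 0 := by exact_mod_cast hp.out.ne_zero
    refine ⟨m, k + n, ?_⟩
    rw [zpow_add₀ hp0, zpow_natCast, val, h, mul_assoc]⟩

theorem val_mulPow (e : Exponent p) (n : ℕ) : (e.mulPow n).val = e.val * (p : ℚ) ^ n := rfl

theorem divPow_mulPow (e : Exponent p) (n : ℕ) : (e.mulPow n).divPow n = e := by
  ext
  rw [val_divPow, val_mulPow, mul_div_cancel_right₀ _ (natCast_pow_ne_zero p n)]

theorem val_ofNat_divPow_mul (j n : ℕ) : ((ofNat p j).divPow n).val * (p : ℚ) ^ n = j := by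
  rw [val_divPow, val_ofNat, div_mul_cancel₀ _ (natCast_pow_ne_zero p n)]

theorem eq_ofNat_divPow {e : Exponent p} {n j : ℕ} (h : e.val * (p : ℚ) ^ n = j) :
    e = (ofNat p j).divPow n := by
  ext
  rw [val_divPow, val_ofNat, ← h, mul_div_cancel_right₀ _ (natCast_pow_ne_zero p n)]

theorem exists_mul_pow_eq (e : Exponent p) : ∃ n j : ℕ, e.val * (p : ℚ) ^ n = j := by
  have hp0 : (p : ℚ) ≠ 0 := by exact_mod_cast hp.out.ne_zero
  obtain ⟨m, n, h⟩ := e.2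
  refine ⟨(-n).toNat, m * p ^ n.toNat, ?_⟩
  rw [val, h]
  push_cast
  rw [← zpow_natCast, ← zpow_natCast, mul_assoc, ← zpow_add₀ hp0]
  congr 2
  omega

theorem mul_pow_add {e : Exponent p} {n j : ℕ} (h : e.val * (p : ℚ) ^ n = j) (k : ℕ) :
    e.val * (p : ℚ) ^ (n + k) = (j * p ^ k : ℕ) := by
  rw [pow_add, ← mul_assoc, h]
  push_cast
  rfl

theorem val_cast_nonneg (e : Exponent p) : 0 ≤ ((e.val : ℚ) : ℝ) := by exact_mod_cast e.val_nonneg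

end Exponent

theorem rpow_pow_eq {R : ℝ} (hR : 0 ≤ R) {e : Exponent p} {n j : ℕ}
    (h : e.val * (p : ℚ) ^ n = j) : (R ^ ((e.val : ℚ) : ℝ)) ^ p ^ n = R ^ j := by
  rw [← Real.rpow_natCast, ← Real.rpow_mul hR, ← Real.rpow_natCast R]
  congr 1
  have : (((e.val * (p : ℚ) ^ n : ℚ)) : ℝ) = ((j : ℚ) : ℝ) := by rw [h]
  push_cast at this ⊢
  exact this

end Exponents

/-! ### Polynomial approximations of `p ^ n`-th powers and normalised root counts -/

section Approximation

variable {p : ℕ} [hp : Fact p.Prime] {F : Type*} [NormedField F]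

/-- The size `|b_e| R ^ e` of the term of exponent `e` on the disc of radius `R`. -/
def termNorm (b : Exponent p → F) (R : ℝ) (e : Exponent p) : ℝ :=
  ‖b e‖ * R ^ ((e.val : ℚ) : ℝ)

theorem termNorm_nonneg (b : Exponent p → F) {R : ℝ} (hR : 0 ≤ R) (e : Exponent p) :
    0 ≤ termNorm b R e := by
  unfold termNorm; positivity

theorem termNorm_mono (b : Exponent p → F) {R R' : ℝ} (hR : 0 ≤ R) (h : R ≤ R') (e : Exponent p) :
    termNorm b R e ≤ termNorm b R' e := by
  unfold termNorm
  gcongr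
  exact e.val_cast_nonneg

theorem termNorm_pow (b : Exponent p → F) {R : ℝ} (hR : 0 ≤ R) {e : Exponent p} {n j : ℕ}
    (h : e.val * (p : ℚ) ^ n = j) : termNorm b R e ^ p ^ n = ‖b e ^ p ^ n‖ * R ^ j := by
  rw [termNorm, mul_pow, rpow_pow_eq hR h, norm_pow]

theorem norm_fracPow [CharP F p] [PerfectRing F p] (z : F) (e : Exponent p) :
    ‖fracPow p z e‖ = ‖z‖ ^ ((e.val : ℚ) : ℝ) := by
  obtain ⟨n, j, h⟩ := e.exists_mul_pow_eq
  refine (pow_left_inj₀ (norm_nonneg _) (by positivity) (pow_ne_zero n hp.out.ne_zero)).mp ?_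
  rw [rpow_pow_eq (norm_nonneg z) h, ← norm_pow, fracPow_pow_eq z e j n h, norm_pow]

theorem norm_term [CharP F p] [PerfectRing F p] (b : Exponent p → F) (z : F) (e : Exponent p) :
    ‖b e * fracPow p z e‖ = termNorm b ‖z‖ e := by
  rw [norm_mul, norm_fracPow, termNorm]

/-- The radius `R` need not be the norm of an element, so it is dominated by that of a power of some
`z` with `1 < ‖z‖`. -/
theorem tendsto_termNorm [CharP F p] [PerfectRing F p] {b : Exponent p → F} (hb : b ∈ seriesP p F)
    {R : ℝ} (hR : 0 ≤ R) : Tendsto (termNorm b R) cofinite (𝓝 0) := by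
  have key : ∀ z : F, Tendsto (termNorm b ‖z‖) cofinite (𝓝 0) := fun z => by
    have := (hb z).norm
    simp only [norm_term, norm_zero] at this
    exact this
  by_cases h : ∃ z : F, 1 < ‖z‖
  · obtain ⟨z, hz⟩ := h
    obtain ⟨n, hn⟩ := pow_unbounded_of_one_lt R hz
    refine squeeze_zero (fun e => termNorm_nonneg b hR e) (fun e => ?_) (key (z ^ n))
    exact termNorm_mono b hR (by rw [norm_pow]; exact hn.le) e
  · push Not at h
    have h1 : ∀ z : F, ‖z‖ < 1 → z = 0 := fun z hz => by
      by_contra h0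
      have := h z⁻¹
      rw [norm_inv] at this
      exact absurd hz (not_lt.mpr ((inv_le_one₀ (norm_pos_iff.mpr h0)).mp this))
    have h2 := (key 1).eventually (gt_mem_nhds zero_lt_one)
    refine tendsto_const_nhds.congr' ?_
    filter_upwards [h2] with e he
    rw [norm_one, termNorm, Real.one_rpow, mul_one] at he
    rw [termNorm, h1 _ he, norm_zero, zero_mul]

/-- `Q` approximates the `p ^ n`-th power of the series `b` on the disc of radius `R` around `0`,
with an error of at most `ε ^ p ^ n`. -/
structure Approx (b : Exponent p → F) (R ε : ℝ) (n : ℕ) (Q : F[X]) : Prop where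
  coeff_le : ∀ (e : Exponent p) (j : ℕ), e.val * (p : ℚ) ^ n = j →
    ‖Q.coeff j - b e ^ p ^ n‖ * R ^ j ≤ ε ^ p ^ n
  termNorm_le : ∀ e : Exponent p, (∀ j : ℕ, e.val * (p : ℚ) ^ n ≠ j) → termNorm b R e ≤ ε

theorem Approx.mono {b : Exponent p → F} {R R' ε ε' : ℝ} {n : ℕ} {Q : F[X]}
    (h : Approx b R' ε' n Q) (hR : 0 ≤ R) (hRR' : R ≤ R') (hε' : 0 ≤ ε') (hε : ε' ≤ ε) :
    Approx b R ε n Q := by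
  refine ⟨fun e j hj => le_trans ?_ ((h.coeff_le e j hj).trans ?_), fun e he =>
    (termNorm_mono b hR hRR' e).trans ((h.termNorm_le e he).trans hε)⟩ <;> gcongr

theorem exists_approx_of_termNorm_le [CharP F p] [PerfectRing F p] {b : Exponent p → F}
    (hb : b ∈ seriesP p F) {R ε : ℝ} (hR : 0 ≤ R) (hε : 0 < ε) {n : ℕ}
    (h : ∀ e : Exponent p, (∀ j : ℕ, e.val * (p : ℚ) ^ n ≠ j) → termNorm b R e ≤ ε) :
    ∃ Q : F[X], Approx b R ε n Q := by
  have hfin : {e | ¬ termNorm b R e < ε}.Finite :=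
    (tendsto_termNorm hb hR).eventually (gt_mem_nhds hε)
  obtain ⟨D, hD⟩ : ∃ D : ℕ, ∀ e, ε ≤ termNorm b R e → e.val * (p : ℚ) ^ n < D := by
    obtain ⟨M, hM⟩ := (hfin.image fun e => e.val * (p : ℚ) ^ n).bddAbove
    obtain ⟨D, hD⟩ := exists_nat_gt M
    exact ⟨D, fun e he => (hM ⟨e, not_lt.mpr he, rfl⟩).trans_lt hD⟩
  refine ⟨∑ j ∈ Finset.range D, monomial j (b ((Exponent.ofNat p j).divPow n) ^ p ^ n),
    fun e j hj => ?_, h⟩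
  rw [Polynomial.finsetSum_coeff]
  simp only [coeff_monomial, Finset.sum_ite_eq', Finset.mem_range]
  rw [← Exponent.eq_ofNat_divPow hj]
  split_ifs with hjD
  · rw [sub_self, norm_zero, zero_mul]
    positivity
  · rw [zero_sub, norm_neg, ← termNorm_pow b hR hj]
    refine pow_le_pow_left₀ (termNorm_nonneg b hR e) ?_ _
    by_contra! hlt
    have := hD e hlt.le
    rw [hj] at this
    exact hjD (by exact_mod_cast this)

/-- Only finitely many terms exceed `ε`, so their exponents have a common denominator `p ^ N`. -/
theorem exists_approx [CharP F p] [PerfectRing F p] {b : Exponent p → F}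
    (hb : b ∈ seriesP p F) {R ε : ℝ} (hR : 0 ≤ R) (hε : 0 < ε) :
    ∃ (n : ℕ) (Q : F[X]), Approx b R ε n Q := by
  have hfin : {e | ¬ termNorm b R e < ε}.Finite :=
    (tendsto_termNorm hb hR).eventually (gt_mem_nhds hε)
  choose n j hnj using Exponent.exists_mul_pow_eq (p := p)
  obtain ⟨N, hN⟩ := (hfin.image n).bddAbove
  refine ⟨N, exists_approx_of_termNorm_le hb hR hε fun e he => ?_⟩
  by_contra! hlt
  have h1 : n e ≤ N := hN ⟨e, not_lt.mpr hlt.le, rfl⟩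
  obtain ⟨k, rfl⟩ := Nat.exists_eq_add_of_le h1
  exact he _ (Exponent.mul_pow_add (hnj e) k)

theorem coeff_pow_char_pow [CharP F p] (Q : F[X]) (k i : ℕ) :
    (Q ^ p ^ k).coeff (i * p ^ k) = Q.coeff i ^ p ^ k := by
  rw [← map_iterateFrobenius_expand, coeff_map, coeff_expand_mul (pow_pos hp.out.pos k),
    iterateFrobenius_def]

theorem coeff_pow_char_pow_of_not_dvd [CharP F p] (Q : F[X]) {k j : ℕ} (h : ¬ p ^ k ∣ j) :
    (Q ^ p ^ k).coeff j = 0 := by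
  rw [← map_iterateFrobenius_expand, coeff_map, coeff_expand (pow_pos hp.out.pos k), if_neg h,
    map_zero]

/-- Additivity of Frobenius turns an error `ε ^ p ^ n` into `ε ^ p ^ (n + k)`: the normalised error
stays `ε`. This is what lets different levels be compared. -/
theorem Approx.pow [CharP F p] {b : Exponent p → F} {R ε : ℝ} {n : ℕ} {Q : F[X]} (hR : 0 ≤ R)
    (h : Approx b R ε n Q) (k : ℕ) : Approx b R ε (n + k) (Q ^ p ^ k) := by
  refine ⟨fun e j hj => ?_, fun e he => h.termNorm_le e fun j hj =>
    he _ (Exponent.mul_pow_add hj k)⟩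
  by_cases hi : ∃ i : ℕ, e.val * (p : ℚ) ^ n = i
  · obtain ⟨i, hi⟩ := hi
    obtain rfl : j = i * p ^ k := by
      have := Exponent.mul_pow_add hi k
      rw [hj] at this
      exact_mod_cast this
    rw [coeff_pow_char_pow, pow_add, pow_mul (b e), ← sub_pow_char_pow, norm_pow, pow_mul R,
      ← mul_pow, pow_mul ε]
    exact pow_le_pow_left₀ (by positivity) (h.coeff_le e i hi) _
  · push Not at hi
    rw [coeff_pow_char_pow_of_not_dvd, zero_sub, norm_neg, ← termNorm_pow b hR hj]
    · exact pow_le_pow_left₀ (termNorm_nonneg b hR e) (h.termNorm_le e hi) _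
    · rintro ⟨i, rfl⟩
      refine hi i (mul_right_cancel₀ (natCast_pow_ne_zero p k) ?_)
      rw [mul_assoc, ← pow_add, hj]
      push_cast
      ring

theorem termNorm_frobPow (b : Exponent p → F) {R : ℝ} (hR : 0 ≤ R) (n : ℕ) (e : Exponent p) :
    termNorm (frobPow p n b) R e = termNorm b R (e.divPow n) ^ p ^ n := by
  rw [termNorm, termNorm, frobPow, mul_pow, norm_pow, ← Real.rpow_natCast (R ^ _),
    ← Real.rpow_mul hR]
  congr 2
  rw [Exponent.val_divPow]
  have := natCast_pow_ne_zero p n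
  have h2 : ((p : ℝ)) ^ n ≠ 0 := by exact_mod_cast this
  push_cast
  rw [div_mul_cancel₀ _ h2]

theorem Approx.of_frobPow {b : Exponent p → F} {R ε : ℝ} {n m : ℕ} {Q : F[X]} (hR : 0 ≤ R)
    (hε : 0 ≤ ε) (h : Approx (frobPow p n b) R (ε ^ p ^ n) m Q) : Approx b R ε (n + m) Q := by
  have hval : ∀ e : Exponent p, (e.mulPow n).val * (p : ℚ) ^ m = e.val * (p : ℚ) ^ (n + m) :=
    fun e => by rw [Exponent.val_mulPow, pow_add, mul_assoc]
  refine ⟨fun e j hj => ?_, fun e he => ?_⟩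
  · have := h.coeff_le (e.mulPow n) j (by rw [hval, hj])
    rwa [frobPow, Exponent.divPow_mulPow, ← pow_mul, ← pow_add, ← pow_mul, ← pow_add] at this
  · have := h.termNorm_le (e.mulPow n) (by simpa only [hval] using he)
    rw [termNorm_frobPow b hR, Exponent.divPow_mulPow] at this
    exact le_of_pow_le_pow_left₀ (pow_ne_zero n hp.out.ne_zero) hε this

variable [IsUltrametricDist F]

theorem Approx.of_termNorm_sub_le [CharP F p] {a b : Exponent p → F} {R ε : ℝ} {n : ℕ} {Q : F[X]}
    (hR : 0 ≤ R) (h : Approx b R ε n Q) (hab : ∀ e, termNorm (a - b) R e ≤ ε) :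
    Approx a R ε n Q := by
  refine ⟨fun e j hj => ?_, fun e he => ?_⟩
  · have h1 := norm_sub_le_max' (Q.coeff j - b e ^ p ^ n) ((a - b) e ^ p ^ n)
    have h2 : Q.coeff j - b e ^ p ^ n - (a - b) e ^ p ^ n = Q.coeff j - a e ^ p ^ n := by
      rw [Pi.sub_apply, sub_pow_char_pow]
      ring
    rw [h2] at h1
    refine (mul_le_mul_of_nonneg_right h1 (by positivity)).trans ?_
    rw [max_mul_of_nonneg _ _ (by positivity), ← termNorm_pow (a - b) hR hj]
    exact max_le (h.coeff_le e j hj) (pow_le_pow_left₀ (termNorm_nonneg _ hR e) (hab e) _)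
  · have h1 := IsUltrametricDist.norm_add_le_max ((a - b) e) (b e)
    rw [Pi.sub_apply, sub_add_cancel] at h1
    have h2 : termNorm a R e ≤ max (termNorm (a - b) R e) (termNorm b R e) := by
      unfold termNorm
      rw [← max_mul_of_nonneg _ _ (by positivity)]
      gcongr
      exact h1
    exact h2.trans (max_le (hab e) (h.termNorm_le e he))

theorem Approx.norm_coeff_sub_le {b : Exponent p → F} {R ε : ℝ} {n : ℕ} {Q Q' : F[X]}
    (hR : 0 ≤ R) (h : Approx b R ε n Q) (h' : Approx b R ε n Q') (j : ℕ) :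
    ‖(Q - Q').coeff j‖ * R ^ j ≤ ε ^ p ^ n := by
  have hj := Exponent.val_ofNat_divPow_mul (p := p) j n
  have h1 := norm_sub_le_max' (Q.coeff j - b ((Exponent.ofNat p j).divPow n) ^ p ^ n)
    (Q'.coeff j - b ((Exponent.ofNat p j).divPow n) ^ p ^ n)
  rw [sub_sub_sub_cancel_right, ← coeff_sub] at h1
  refine (mul_le_mul_of_nonneg_right h1 (by positivity)).trans ?_
  rw [max_mul_of_nonneg _ _ (by positivity)]
  exact max_le (h.coeff_le _ j hj) (h'.coeff_le _ j hj)

/-- The exponent `e` is the last one at which the term of `b` on the disc of radius `R` around `0`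
has maximal size. -/
structure IsLastMax (b : Exponent p → F) (R : ℝ) (e : Exponent p) : Prop where
  pos : 0 < termNorm b R e
  le : ∀ e', termNorm b R e' ≤ termNorm b R e
  lt : ∀ e', e.val < e'.val → termNorm b R e' < termNorm b R e

/-- The exponent `e` is the first one at which the term of `b` on the disc of radius `R` around `0`
has maximal size. -/
structure IsFirstMax (b : Exponent p → F) (R : ℝ) (e : Exponent p) : Prop where
  pos : 0 < termNorm b R e
  le : ∀ e', termNorm b R e' ≤ termNorm b R e
  lt : ∀ e', e'.val < e.val → termNorm b R e' < termNorm b R e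

theorem finite_le_termNorm [CharP F p] [PerfectRing F p] {b : Exponent p → F}
    (hb : b ∈ seriesP p F) {R ε : ℝ} (hR : 0 ≤ R) (hε : 0 < ε) :
    {e | ε ≤ termNorm b R e}.Finite := by
  simpa [Filter.eventually_cofinite] using
    (tendsto_termNorm hb hR).eventually (gt_mem_nhds hε)

theorem exists_termNorm_max [CharP F p] [PerfectRing F p] {b : Exponent p → F}
    (hb : b ∈ seriesP p F) (h0 : b ≠ 0) {R : ℝ} (hR : 0 < R) :
    ∃ e, 0 < termNorm b R e ∧ ∀ e', termNorm b R e' ≤ termNorm b R e := by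
  obtain ⟨e₁, he₁⟩ := Function.ne_iff.mp h0
  have hpos : 0 < termNorm b R e₁ := mul_pos (norm_pos_iff.mpr he₁) (by positivity)
  obtain ⟨e, he, hmax⟩ := (finite_le_termNorm hb hR.le hpos).exists_maximalFor (termNorm b R) _
    ⟨e₁, le_refl (termNorm b R e₁)⟩
  refine ⟨e, hpos.trans_le he, fun e' => ?_⟩
  by_contra! hlt
  exact hlt.not_ge (hmax (he.trans hlt.le) hlt.le)

theorem exists_isLastMax [CharP F p] [PerfectRing F p] {b : Exponent p → F}
    (hb : b ∈ seriesP p F) (h0 : b ≠ 0) {R : ℝ} (hR : 0 < R) : ∃ e, IsLastMax b R e := by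
  obtain ⟨e₁, hpos, hle⟩ := exists_termNorm_max hb h0 hR
  obtain ⟨e, he, hmax⟩ := (finite_le_termNorm hb hR.le hpos).exists_maximalFor Exponent.val _
    ⟨e₁, le_refl (termNorm b R e₁)⟩
  refine ⟨e, hpos.trans_le he, fun e' => (hle e').trans he, fun e' hlt => ?_⟩
  by_contra! hge
  exact hlt.not_ge (hmax (he.trans hge) hlt.le)

theorem exists_isFirstMax [CharP F p] [PerfectRing F p] {b : Exponent p → F}
    (hb : b ∈ seriesP p F) (h0 : b ≠ 0) {R : ℝ} (hR : 0 < R) : ∃ e, IsFirstMax b R e := by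
  obtain ⟨e₁, hpos, hle⟩ := exists_termNorm_max hb h0 hR
  obtain ⟨e, he, hmin⟩ := (finite_le_termNorm hb hR.le hpos).exists_minimalFor Exponent.val _
    ⟨e₁, le_refl (termNorm b R e₁)⟩
  refine ⟨e, hpos.trans_le he, fun e' => (hle e').trans he, fun e' hlt => ?_⟩
  by_contra! hge
  exact hlt.not_ge (hmin (he.trans hge) hlt.le)

/-- The error lies below the maximal term, so it cannot disturb the last maximum; and the
denominator of `e` divides `p ^ n`, since otherwise its term would be at most `ε`. -/
theorem Approx.isDominant {b : Exponent p → F} {R ε : ℝ} {n : ℕ} {Q : F[X]} {e : Exponent p}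
    (hR : 0 < R) (hε : 0 ≤ ε) (he : IsLastMax b R e) (hlt : ε < termNorm b R e)
    (h : Approx b R ε n Q) :
    ∃ j : ℕ, e.val * (p : ℚ) ^ n = j ∧ IsDominant Q R (termNorm b R e ^ p ^ n) j := by
  have hq : p ^ n ≠ 0 := pow_ne_zero n hp.out.ne_zero
  obtain ⟨j, hj⟩ : ∃ j : ℕ, e.val * (p : ℚ) ^ n = j := by
    by_contra! hne
    exact hlt.not_ge (h.termNorm_le e hne)
  have hεM : ε ^ p ^ n < termNorm b R e ^ p ^ n := pow_lt_pow_left₀ hlt hε hq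
  have key : ∀ i, ‖Q.coeff i‖ * R ^ i ≤
      max (ε ^ p ^ n) (termNorm b R ((Exponent.ofNat p i).divPow n) ^ p ^ n) := fun i => by
    have hi := Exponent.val_ofNat_divPow_mul (p := p) i n
    have h1 := IsUltrametricDist.norm_add_le_max
      (Q.coeff i - b ((Exponent.ofNat p i).divPow n) ^ p ^ n)
      (b ((Exponent.ofNat p i).divPow n) ^ p ^ n)
    rw [sub_add_cancel] at h1
    refine (mul_le_mul_of_nonneg_right h1 (by positivity)).trans ?_
    rw [max_mul_of_nonneg _ _ (by positivity), ← termNorm_pow b hR.le hi]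
    exact max_le_max_right _ (h.coeff_le _ i hi)
  refine ⟨j, hj, pow_pos he.pos _, fun i => (key i).trans (max_le hεM.le ?_), ?_, fun i hi =>
    (key i).trans_lt (max_lt hεM ?_)⟩
  · exact pow_le_pow_left₀ (termNorm_nonneg b hR.le _) (he.le _) _
  · have h1 := (h.coeff_le e j hj).trans_lt hεM
    rw [termNorm_pow b hR.le hj] at h1 ⊢
    rw [norm_sub_rev] at h1
    rw [norm_eq_of_norm_sub_lt (lt_of_mul_lt_mul_right h1 (by positivity))]
  · refine pow_lt_pow_left₀ (he.lt _ ?_) (termNorm_nonneg b hR.le _) hq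
    rw [← mul_lt_mul_iff_of_pos_right (show (0 : ℚ) < (p : ℚ) ^ n by
      have := hp.out.pos; positivity), hj, Exponent.val_ofNat_divPow_mul]
    exact_mod_cast hi

variable [IsAlgClosed F]

/-- At radius `R` the Gauss norm of `Q` is the `p ^ n`-th power of the maximal term of `b`, and `Q`
has `e * p ^ n` roots in that disc. Shrinking to radius `δ` around any `x` in it therefore costs at
most the factor `(δ / R) ^ (e * p ^ n)`, again a `p ^ n`-th power of something independent of `n`.
-/
theorem exists_discNorm_lower_bound [CharP F p] [PerfectRing F p] {b : Exponent p → F}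
    (hb : b ∈ seriesP p F) (h0 : b ≠ 0) {R δ : ℝ} (hδ : 0 < δ) (hδR : δ ≤ R) :
    ∃ l : ℝ, 0 < l ∧ ∀ (ε : ℝ) (n : ℕ) (Q : F[X]), 0 ≤ ε → ε < l → Approx b R ε n Q →
      Q ≠ 0 ∧ ∀ x : F, ‖x‖ ≤ R → l ^ p ^ n ≤ discNorm Q x δ := by
  have hR := hδ.trans_le hδR
  obtain ⟨e, he⟩ := exists_isLastMax hb h0 hR
  have hpos := he.pos
  refine ⟨termNorm b R e * (δ / R) ^ ((e.val : ℚ) : ℝ), by positivity,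
    fun ε n Q hε hlt h => ?_⟩
  have hlt' : ε < termNorm b R e := hlt.trans_le (mul_le_of_le_one_right hpos.le
    (Real.rpow_le_one (by positivity) ((div_le_one hR).mpr hδR) e.val_cast_nonneg))
  obtain ⟨j, hj, hd⟩ := h.isDominant hR hε he hlt'
  have hQ := hd.ne_zero
  refine ⟨hQ, fun x hx => ?_⟩
  have h1 := isDominant_taylor hQ 0 hR
  rw [taylor_zero] at h1
  obtain ⟨h2, h3⟩ := hd.unique h1
  have h4 := discNorm_mul_pow_le hQ x hδ hδR
  rwa [discNorm_recenter Q (β := 0) (by simpa using hx),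
    rootCount_recenter Q (β := 0) (by simpa using hx), ← h2, ← h3,
    ← rpow_pow_eq (by positivity) hj, ← mul_pow] at h4

/-- All sufficiently good approximations of `b` have `N` roots in the disc, in the sense of
multiplicities divided by `p ^ n`. -/
def HasCount (b : Exponent p → F) (α : F) (r : ℝ) (N : ℝ≥0∞) : Prop :=
  ∃ R ε : ℝ, 0 < ε ∧ ‖α‖ ≤ R ∧ r ≤ R ∧ ∀ (n : ℕ) (Q : F[X]), Approx b R ε n Q →
    (rootCount Q α r : ℝ≥0∞) / (p : ℝ≥0∞) ^ n = N

theorem rootCount_div_pow [CharP F p] (Q : F[X]) (α : F) (r : ℝ) (n k : ℕ) :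
    (rootCount (Q ^ p ^ k) α r : ℝ≥0∞) / (p : ℝ≥0∞) ^ (n + k) =
      rootCount Q α r / (p : ℝ≥0∞) ^ n := by
  have hp0 : (p : ℝ≥0∞) ≠ 0 := by exact_mod_cast hp.out.ne_zero
  rw [rootCount_pow, pow_add, mul_comm ((p : ℝ≥0∞) ^ n)]
  push_cast
  exact ENNReal.mul_div_mul_left _ _ (pow_ne_zero _ hp0)
    (ENNReal.pow_ne_top (ENNReal.natCast_ne_top p))

/-- Two approximations of levels `n` and `n'` are both raised to level `n + n'`, where they differ
by at most `(l / 2) ^ p ^ (n + n')`, below the Gauss norm. -/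
theorem exists_hasCount [CharP F p] [PerfectRing F p] {b : Exponent p → F}
    (hb : b ∈ seriesP p F) (h0 : b ≠ 0) (α : F) {r : ℝ} (hr : 0 < r) :
    ∃ N, HasCount b α r N := by
  have hrR : r ≤ max ‖α‖ r := le_max_right _ _
  have hR : 0 ≤ max ‖α‖ r := hr.le.trans hrR
  obtain ⟨l, hl, H⟩ := exists_discNorm_lower_bound hb h0 hr hrR
  obtain ⟨n, Q, hQ⟩ := exists_approx hb hR (half_pos hl)
  refine ⟨rootCount Q α r / (p : ℝ≥0∞) ^ n, max ‖α‖ r, l / 2, half_pos hl, le_max_left _ _, hrR,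
    fun n' Q' hQ' => ?_⟩
  rw [← rootCount_div_pow Q α r n n', ← rootCount_div_pow Q' α r n' n, add_comm n' n]
  have h1 := hQ.pow hR n'
  have h2 := hQ'.pow hR n
  rw [add_comm n' n] at h2
  obtain ⟨hne, hlow⟩ := H _ _ _ (half_pos hl).le (half_lt_self hl) h1
  rw [rootCount_eq_of_coeff_sub hne hr hrR (le_max_left _ _) (h1.norm_coeff_sub_le hR h2)]
  exact (pow_lt_pow_left₀ (half_lt_self hl) (half_pos hl).le
    (pow_ne_zero _ hp.out.ne_zero)).trans_le (hlow α (le_max_left _ _))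

/-- Enlarging `R` and shrinking `ε` preserves the property, so several counts can be tested on a
single approximation. -/
theorem HasCount.forall_approx {b : Exponent p → F} {α : F} {r : ℝ} {N : ℝ≥0∞}
    (h : HasCount b α r N) : ∃ R₀ ε₀ : ℝ, 0 < R₀ ∧ 0 < ε₀ ∧ ∀ R ε : ℝ, R₀ ≤ R → 0 ≤ ε → ε ≤ ε₀ →
      ∀ (n : ℕ) (Q : F[X]), Approx b R ε n Q → (rootCount Q α r : ℝ≥0∞) / (p : ℝ≥0∞) ^ n = N := by
  obtain ⟨R, ε, hε, hα, -, H⟩ := h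
  have hR := (norm_nonneg α).trans hα
  exact ⟨max R 1, ε, by positivity, hε, fun R' ε' hR' hε' hle n Q hQ =>
    H n Q (hQ.mono hR ((le_max_left _ _).trans hR') hε' hle)⟩

theorem HasCount.unique [CharP F p] [PerfectRing F p] {b : Exponent p → F}
    (hb : b ∈ seriesP p F) {α : F} {r : ℝ} {N N' : ℝ≥0∞} (h : HasCount b α r N)
    (h' : HasCount b α r N') : N = N' := by
  obtain ⟨R, ε, hR, hε, H⟩ := h.forall_approx
  obtain ⟨R', ε', hR', hε', H'⟩ := h'.forall_approx
  obtain ⟨n, Q, hQ⟩ := exists_approx hb (R := max R R') (by positivity) (lt_min hε hε')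
  rw [← H _ _ (le_max_left _ _) (by positivity) (min_le_left _ _) n Q hQ,
    ← H' _ _ (le_max_right _ _) (by positivity) (min_le_right _ _) n Q hQ]

theorem HasCount.ne_top [CharP F p] [PerfectRing F p] {b : Exponent p → F}
    (hb : b ∈ seriesP p F) {α : F} {r : ℝ} {N : ℝ≥0∞} (h : HasCount b α r N) : N ≠ ⊤ := by
  obtain ⟨R, ε, hR, hε, H⟩ := h.forall_approx
  obtain ⟨n, Q, hQ⟩ := exists_approx hb hR.le hε
  rw [← H R ε le_rfl hε.le le_rfl n Q hQ]
  exact ENNReal.div_ne_top (ENNReal.natCast_ne_top _)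
    (pow_ne_zero _ (by exact_mod_cast hp.out.ne_zero))

theorem HasCount.frobPow {b : Exponent p → F} {α : F} {r : ℝ} {N : ℝ≥0∞} {n : ℕ}
    (h : HasCount b α r N) : HasCount (frobPow p n b) α r ((p : ℝ≥0∞) ^ n * N) := by
  obtain ⟨R, ε, hε, hα, hr, H⟩ := h
  have hp0 : (p : ℝ≥0∞) ≠ 0 := by exact_mod_cast hp.out.ne_zero
  refine ⟨R, ε ^ p ^ n, by positivity, hα, hr, fun m Q hQ => ?_⟩
  rw [← H (n + m) Q (hQ.of_frobPow ((norm_nonneg α).trans hα) hε.le), pow_add, ← mul_div_assoc,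
    ENNReal.mul_div_mul_left _ _ (pow_ne_zero _ hp0)
    (ENNReal.pow_ne_top (ENNReal.natCast_ne_top p))]

/-- The count is locally constant in the series: approximations of a nearby series also approximate
`b`. -/
theorem HasCount.exists_forall_termNorm_sub_le [CharP F p] {b : Exponent p → F} {α : F} {r : ℝ}
    {N : ℝ≥0∞} (h : HasCount b α r N) : ∃ R ε : ℝ, 0 ≤ R ∧ 0 < ε ∧ ∀ b' : Exponent p → F,
      (∀ e, termNorm (b - b') R e ≤ ε) → HasCount b' α r N := by
  obtain ⟨R, ε, hε, hα, hr, H⟩ := h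
  have hR := (norm_nonneg α).trans hα
  exact ⟨R, ε, hR, hε, fun b' hb' => ⟨R, ε, hε, hα, hr, fun n Q hQ =>
    H n Q (hQ.of_termNorm_sub_le hR hb')⟩⟩

/-- Every good approximation has exactly `e * p ^ n` roots in the disc, whatever `n` is. -/
theorem IsLastMax.hasCount {b : Exponent p → F} {R : ℝ} (hR : 0 < R) {e : Exponent p}
    (h : IsLastMax b R e) : HasCount b 0 R (ENNReal.ofReal (e.val : ℝ)) := by
  have hpos := h.pos
  refine ⟨R, termNorm b R e / 2, half_pos hpos, by simpa using hR.le, le_rfl, fun n Q hQ => ?_⟩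
  obtain ⟨j, hj, hd⟩ := hQ.isDominant hR (half_pos hpos).le h (half_lt_self hpos)
  have h1 := isDominant_taylor hd.ne_zero 0 hR
  rw [taylor_zero] at h1
  rw [← (hd.unique h1).2]
  have hp0 : (0 : ℝ) < (p : ℝ) ^ n := by
    have := hp.out.pos
    positivity
  have h2 : ((e.val : ℚ) : ℝ) = j / (p : ℝ) ^ n := by
    rw [eq_div_iff hp0.ne']
    have : (((e.val * (p : ℚ) ^ n : ℚ)) : ℝ) = ((j : ℚ) : ℝ) := by rw [hj]
    push_cast at this
    exact this
  rw [h2, ENNReal.ofReal_div_of_pos hp0, ENNReal.ofReal_natCast, ENNReal.ofReal_pow (by positivity),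
    ENNReal.ofReal_natCast]

end Approximation

end

/-! ### Zeros of series and roots of their approximations -/

section

open Polynomial

section Zeros

variable {p : ℕ} [hp : Fact p.Prime] {F : Type*} [NormedField F] [IsUltrametricDist F]
  [CompleteSpace F] [CharP F p] [PerfectRing F p]

theorem Approx.norm_eval_sub_le {b : Exponent p → F} (hb : b ∈ seriesP p F) {R ε : ℝ} {n : ℕ}
    {Q : F[X]} (hε : 0 ≤ ε) (h : Approx b R ε n Q) {x : F} (hx : ‖x‖ ≤ R) :
    ‖Q.eval x - eval p b x ^ p ^ n‖ ≤ ε ^ p ^ n := by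
  classical
  have hR : 0 ≤ R := (norm_nonneg x).trans hx
  set g : ℕ → Exponent p := fun j => (Exponent.ofNat p j).divPow n with hg
  have hgj : ∀ j, (g j).val * (p : ℚ) ^ n = j := fun j => Exponent.val_ofNat_divPow_mul j n
  have hinj : Function.Injective g := fun i j hij => by
    have := hgj i
    rw [hij, hgj] at this
    exact_mod_cast this.symm
  -- The exponents with `e * p ^ n` an integer in the degree range of `Q`; the `p ^ n`-th power of
  -- this partial sum is an ordinary polynomial expression in `x`.
  set S : Finset (Exponent p) := (Finset.range (Q.natDegree + 1)).image g with hS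
  set T : F := ∑ e ∈ S, b e * fracPow p x e with hT
  have h1 : ‖eval p b x - T‖ ≤ ε := by
    rw [eval, ← (summable_of_mem hb x).sum_add_tsum_compl (s := S), ← hT, add_sub_cancel_left]
    refine IsUltrametricDist.norm_tsum_le_of_forall_le_of_nonneg hε fun e => ?_
    rw [norm_term]
    refine (termNorm_mono b (norm_nonneg x) hx _).trans ?_
    by_cases hj : ∃ j : ℕ, (e : Exponent p).val * (p : ℚ) ^ n = j
    · obtain ⟨j, hj⟩ := hj
      -- Beyond the degree of `Q` the coefficient estimate compares with `0`, so the term itself is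
      -- at most `ε`.
      have hjQ : Q.natDegree < j := by
        by_contra! hle
        refine e.2 (Finset.mem_coe.mpr (Finset.mem_image.mpr ⟨j, by simpa [Nat.lt_succ_iff], ?_⟩))
        exact (Exponent.eq_ofNat_divPow hj).symm
      have := h.coeff_le e j hj
      rw [coeff_eq_zero_of_natDegree_lt hjQ, zero_sub, norm_neg, ← termNorm_pow b hR hj] at this
      exact le_of_pow_le_pow_left₀ (pow_ne_zero n hp.out.ne_zero) hε this
    · push Not at hj
      exact h.termNorm_le e hj
  have h2 : ‖Q.eval x - T ^ p ^ n‖ ≤ ε ^ p ^ n := by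
    rw [hT, hS, Finset.sum_image hinj.injOn, sum_pow_char_pow, eval_eq_sum_range,
      ← Finset.sum_sub_distrib]
    refine IsUltrametricDist.norm_sum_le_of_forall_le_of_nonneg (by positivity) fun j _ => ?_
    rw [mul_pow, fracPow_pow_eq x _ j n (hgj j), ← sub_mul, norm_mul, norm_pow]
    refine le_trans ?_ (h.coeff_le (g j) j (hgj j))
    gcongr
  have h3 : Q.eval x - eval p b x ^ p ^ n = (Q.eval x - T ^ p ^ n) - (eval p b x - T) ^ p ^ n := by
    rw [sub_pow_char_pow]
    ring
  rw [h3]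
  refine (norm_sub_le_max' _ _).trans (max_le h2 ?_)
  rw [norm_pow]
  gcongr

/-- Near `x` the `p ^ n`-th power of the series is uniformly close to a continuous polynomial, and
`p ^ n`-th powers of differences are differences of powers. -/
theorem continuous_eval {b : Exponent p → F} (hb : b ∈ seriesP p F) : Continuous (eval p b) := by
  rw [continuous_iff_continuousAt]
  intro x
  rw [ContinuousAt, Metric.tendsto_nhds]
  intro η hη
  obtain ⟨n, Q, hQ⟩ := exists_approx hb (R := ‖x‖ + 1) (by positivity) (half_pos hη)
  have hq : p ^ n ≠ 0 := pow_ne_zero n hp.out.ne_zero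
  have hpos : 0 < (η / 2) ^ p ^ n := by positivity
  have h1 := (Q.continuous.tendsto x).eventually (Metric.ball_mem_nhds _ hpos)
  have h2 := Metric.ball_mem_nhds x zero_lt_one
  filter_upwards [h1, h2] with y hy1 hy2
  have hy : ‖y‖ ≤ ‖x‖ + 1 := by
    have := norm_add_le x (y - x)
    rw [add_sub_cancel] at this
    rw [Metric.mem_ball, dist_eq_norm] at hy2
    linarith
  have e1 := hQ.norm_eval_sub_le hb (half_pos hη).le hy
  have e2 := hQ.norm_eval_sub_le hb (half_pos hη).le (x := x) (by linarith)
  rw [dist_eq_norm] at hy1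
  have e3 : eval p b y ^ p ^ n - eval p b x ^ p ^ n = (Q.eval y - Q.eval x) -
      ((Q.eval y - eval p b y ^ p ^ n) - (Q.eval x - eval p b x ^ p ^ n)) := by ring
  have e4 : ‖eval p b y - eval p b x‖ ^ p ^ n ≤ (η / 2) ^ p ^ n := by
    rw [← norm_pow, sub_pow_char_pow, e3]
    exact (norm_sub_le_max' _ _).trans (max_le hy1.le
      ((norm_sub_le_max' _ _).trans (max_le e1 e2)))
  rw [dist_eq_norm]
  exact (le_of_pow_le_pow_left₀ hq (half_pos hη).le e4).trans_lt (half_lt_self hη)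

theorem norm_le_of_dist_le {x y : F} {δ R : ℝ} (hy : ‖y‖ ≤ R) (hd : dist x y ≤ δ) (hδ : δ ≤ R) :
    ‖x‖ ≤ R := by
  have := IsUltrametricDist.norm_add_le_max (x - y) y
  rw [sub_add_cancel, ← dist_eq_norm] at this
  exact this.trans (max_le (hd.trans hδ) hy)

variable [IsAlgClosed F]

/-- If `Q` had no root within `δ` of `x`, its Gauss norm there would be `‖Q.eval x‖`, which is below
`l ^ p ^ n` when the value of `b` at `x` is small. Roots of ever better approximations give ever
smaller values of `b`. -/
theorem exists_small_value_near {b : Exponent p → F} (hb : b ∈ seriesP p F) (h0 : b ≠ 0)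
    {R δ : ℝ} (hδ : 0 < δ) (hδR : δ ≤ R) :
    ∃ l : ℝ, 0 < l ∧
      (∀ (ε : ℝ) (n : ℕ) (Q : F[X]), 0 ≤ ε → ε < l → Approx b R ε n Q →
        Q ≠ 0 ∧ ∀ x : F, ‖x‖ ≤ R → ‖eval p b x‖ < l → ∃ y ∈ Q.roots, dist y x ≤ δ) ∧
      ∀ x : F, ‖x‖ ≤ R → ‖eval p b x‖ < l → ∀ η > 0,
        ∃ y : F, dist y x ≤ δ ∧ ‖eval p b y‖ ≤ η := by
  have hR := hδ.trans_le hδR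
  obtain ⟨l, hl, H⟩ := exists_discNorm_lower_bound hb h0 hδ hδR
  have key : ∀ (ε : ℝ) (n : ℕ) (Q : F[X]), 0 ≤ ε → ε < l → Approx b R ε n Q →
      Q ≠ 0 ∧ ∀ x : F, ‖x‖ ≤ R → ‖eval p b x‖ < l → ∃ y ∈ Q.roots, dist y x ≤ δ := by
    intro ε n Q hε hεl hQ
    have hq : p ^ n ≠ 0 := pow_ne_zero n hp.out.ne_zero
    obtain ⟨hQ0, hlow⟩ := H ε n Q hε hεl hQ
    refine ⟨hQ0, fun x hx hfx => ?_⟩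
    by_cases hc : rootCount Q x δ = 0
    · have h1 := hlow x hx
      rw [discNorm_eq_norm_eval hQ0 hδ hc] at h1
      have h2 := IsUltrametricDist.norm_add_le_max (Q.eval x - eval p b x ^ p ^ n)
        (eval p b x ^ p ^ n)
      rw [sub_add_cancel, norm_pow] at h2
      refine absurd (h1.trans h2) (not_le.mpr (max_lt ?_ ?_))
      · exact (hQ.norm_eval_sub_le hb hε hx).trans_lt (pow_lt_pow_left₀ hεl hε hq)
      · exact pow_lt_pow_left₀ hfx (norm_nonneg _) hq
    · obtain ⟨y, hy, hyr⟩ := exists_root_of_rootCount_ne_zero hc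
      exact ⟨y, hyr, hy⟩
  refine ⟨l, hl, key, fun x hx hfx η hη => ?_⟩
  have hε : 0 < min η (l / 2) := by positivity
  obtain ⟨n, Q, hQ⟩ := exists_approx hb hR.le hε
  obtain ⟨hQ0, hroot⟩ := key _ n Q hε.le ((min_le_right _ _).trans_lt (half_lt_self hl)) hQ
  obtain ⟨y, hy, hyx⟩ := hroot x hx hfx
  refine ⟨y, hyx, ?_⟩
  have h1 := hQ.norm_eval_sub_le hb hε.le (norm_le_of_dist_le hx hyx hδR)
  rw [(mem_roots'.mp hy).2, zero_sub, norm_neg, norm_pow] at h1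
  exact (le_of_pow_le_pow_left₀ (pow_ne_zero n hp.out.ne_zero) hε.le h1).trans (min_le_left _ _)

/-- Successive approximation: step `k` moves by at most `δ / 2 ^ k`, and by the ultrametric
inequality the whole sequence stays within `δ` of `x`. -/
theorem exists_zero_near {b : Exponent p → F} (hb : b ∈ seriesP p F) (h0 : b ≠ 0)
    {R δ : ℝ} (hδ : 0 < δ) (hδR : δ ≤ R) :
    ∃ l : ℝ, 0 < l ∧
      (∀ (ε : ℝ) (n : ℕ) (Q : F[X]), 0 ≤ ε → ε < l → Approx b R ε n Q →
        Q ≠ 0 ∧ ∀ x : F, ‖x‖ ≤ R → ‖eval p b x‖ < l → ∃ y ∈ Q.roots, dist y x ≤ δ) ∧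
      ∀ x : F, ‖x‖ ≤ R → ‖eval p b x‖ < l → ∃ z : F, eval p b z = 0 ∧ dist z x ≤ δ := by
  have hδk : ∀ k : ℕ, 0 < δ / 2 ^ k := fun k => by positivity
  have hδkδ : ∀ k : ℕ, δ / 2 ^ k ≤ δ := fun k => div_le_self hδ.le (one_le_pow₀ one_le_two)
  choose l hl hroot hstep using fun k : ℕ =>
    exists_small_value_near hb h0 (hδk k) ((hδkδ k).trans hδR)
  refine ⟨l 0, hl 0, by simpa using hroot 0, fun x hx hfx => ?_⟩
  -- The bound `l (k + 1) / 2` makes the next step possible; `(k + 1)⁻¹` makes the values tend to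
  -- `0`.
  have step : ∀ (k : ℕ) (y : F), ‖y‖ ≤ R ∧ ‖eval p b y‖ < l k → ∃ y' : F, dist y' y ≤ δ / 2 ^ k ∧
      ‖eval p b y'‖ ≤ min (l (k + 1) / 2) ((k : ℝ) + 1)⁻¹ := fun k y hy =>
    hstep k y hy.1 hy.2 _ (lt_min (half_pos (hl _)) (by positivity))
  choose! g hg using step
  let u : ℕ → F := fun k => Nat.rec x (fun k y => g k y) k
  have hu : ∀ k, ‖u k‖ ≤ R ∧ ‖eval p b (u k)‖ < l k := by
    intro k
    induction k with
    | zero => exact ⟨hx, hfx⟩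
    | succ k ih =>
      obtain ⟨h1, h2⟩ := hg k (u k) ih
      exact ⟨norm_le_of_dist_le ih.1 h1 ((hδkδ k).trans hδR),
        (h2.trans (min_le_left _ _)).trans_lt (half_lt_self (hl _))⟩
  -- Written as `C / 2 / 2 ^ k` with `C = δ * 2`, the shape required by
  -- `cauchySeq_of_le_geometric_two`.
  have hdist : ∀ k, dist (u k) (u (k + 1)) ≤ δ * 2 / 2 / 2 ^ k := fun k => by
    rw [dist_comm, mul_div_cancel_right₀ _ two_ne_zero]
    exact (hg k (u k) (hu k)).1
  obtain ⟨z, hz⟩ := cauchySeq_tendsto_of_complete (cauchySeq_of_le_geometric_two hdist)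
  have hball : ∀ k, u k ∈ Metric.closedBall x δ := by
    intro k
    induction k with
    | zero => exact Metric.mem_closedBall_self hδ.le
    | succ k ih =>
      exact (dist_triangle_max (u (k + 1)) (u k) x).trans
        (max_le ((hg k (u k) (hu k)).1.trans (hδkδ k)) ih)
  refine ⟨z, ?_, Metric.isClosed_closedBall.mem_of_tendsto hz (Eventually.of_forall hball)⟩
  have h1 : Tendsto (fun k => eval p b (u (k + 1))) atTop (𝓝 (eval p b z)) :=
    ((continuous_eval hb).tendsto z).comp (hz.comp (tendsto_add_atTop_nat 1))
  have h2 : Tendsto (fun k => eval p b (u (k + 1))) atTop (𝓝 0) := by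
    refine squeeze_zero_norm (fun k => ((hg k (u k) (hu k)).2.trans (min_le_right _ _))) ?_
    simpa using tendsto_one_div_add_atTop_nhds_zero_nat (𝕜 := ℝ)
  exact tendsto_nhds_unique h1 h2

/-- On a disc, the zeros of a series and the roots of a good approximation are close to each
other. -/
theorem exists_forall_approx_roots {b : Exponent p → F} (hb : b ∈ seriesP p F) (h0 : b ≠ 0)
    {R δ : ℝ} (hδ : 0 < δ) (hδR : δ ≤ R) :
    ∃ l : ℝ, 0 < l ∧ ∀ (ε : ℝ) (n : ℕ) (Q : F[X]), 0 ≤ ε → ε < l → Approx b R ε n Q →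
      Q ≠ 0 ∧ (∀ z : F, ‖z‖ ≤ R → eval p b z = 0 → ∃ y ∈ Q.roots, dist y z ≤ δ) ∧
        ∀ y ∈ Q.roots, ‖y‖ ≤ R → ∃ z : F, eval p b z = 0 ∧ dist z y ≤ δ := by
  obtain ⟨l, hl, hroot, hzero⟩ := exists_zero_near hb h0 hδ hδR
  refine ⟨l, hl, fun ε n Q hε hεl hQ => ?_⟩
  obtain ⟨hQ0, hr⟩ := hroot ε n Q hε hεl hQ
  refine ⟨hQ0, fun z hz hfz => hr z hz (by simpa [hfz] using hl), fun y hy hyR => hzero y hyR ?_⟩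
  have h1 := hQ.norm_eval_sub_le hb hε hyR
  rw [(mem_roots'.mp hy).2, zero_sub, norm_neg, norm_pow] at h1
  exact (le_of_pow_le_pow_left₀ (pow_ne_zero n hp.out.ne_zero) hε h1).trans_lt hεl

theorem HasCount.ne_zero {b : Exponent p → F} (hb : b ∈ seriesP p F) (h0 : b ≠ 0) {z : F}
    (hz : eval p b z = 0) {r : ℝ} (hr : 0 < r) {N : ℝ≥0∞} (h : HasCount b z r N) : N ≠ 0 := by
  obtain ⟨R, ε, hR, hε, H⟩ := h.forall_approx
  have hrR : r ≤ max R (max r ‖z‖) := (le_max_left _ _).trans (le_max_right _ _)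
  obtain ⟨l, hl, hroot⟩ := exists_forall_approx_roots hb h0 hr hrR
  have hε' : 0 < min ε (l / 2) := by positivity
  obtain ⟨n, Q, hQ⟩ := exists_approx hb (hr.le.trans hrR) hε'
  obtain ⟨hQ0, h1, -⟩ := hroot _ n Q hε'.le ((min_le_right _ _).trans_lt (half_lt_self hl)) hQ
  obtain ⟨y, hy, hyz⟩ := h1 z ((le_max_right _ _).trans (le_max_right _ _)) hz
  rw [← H _ _ (le_max_left _ _) hε'.le (min_le_left _ _) n Q hQ]
  refine (ENNReal.div_ne_zero.mpr ⟨?_, ENNReal.pow_ne_top (ENNReal.natCast_ne_top p)⟩)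
  exact Nat.cast_ne_zero.mpr (rootCount_ne_zero_of_mem hy hyz)

/-- The finitely many roots of one approximation form a net for the zeros in the disc. -/
theorem isCompact_zeros_inter_closedBall {b : Exponent p → F} (hb : b ∈ seriesP p F) (h0 : b ≠ 0)
    (R : ℝ) : IsCompact {z : F | eval p b z = 0 ∧ ‖z‖ ≤ R} := by
  refine TotallyBounded.isCompact_of_isClosed ?_ ?_
  · rw [Metric.totallyBounded_iff]
    intro δ hδ
    have hδR : δ / 2 ≤ max R (δ / 2) := le_max_right _ _
    obtain ⟨l, hl, hroot⟩ := exists_forall_approx_roots hb h0 (half_pos hδ) hδR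
    obtain ⟨n, Q, hQ⟩ := exists_approx hb ((half_pos hδ).le.trans hδR) (half_pos hl)
    obtain ⟨hQ0, h1, -⟩ := hroot _ n Q (half_pos hl).le (half_lt_self hl) hQ
    refine ⟨{y | y ∈ Q.roots}, ?_, fun z hz => ?_⟩
    · classical
      refine (Q.roots.toFinset.finite_toSet).subset fun y hy => by simpa using hy
    · obtain ⟨y, hy, hyz⟩ := h1 z (hz.2.trans (le_max_left _ _)) hz.1
      simp only [Set.mem_iUnion]
      refine ⟨y, hy, ?_⟩
      rw [Metric.mem_ball, dist_comm]
      exact hyz.trans_lt (half_lt_self hδ)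
  · exact (isClosed_eq (continuous_eval hb) continuous_const).inter
      (isClosed_le continuous_norm continuous_const)

end Zeros

end

/-! ### Measures on proper ultrametric spaces from their values on balls -/

section UltrametricMeasure

variable {X : Type*} [MetricSpace X] [IsUltrametricDist X]

/-- The closed balls of positive radius, together with the empty set. -/
def closedBalls (X : Type*) [MetricSpace X] : Set (Set X) :=
  {S | S = ∅ ∨ ∃ (x : X) (r : ℝ), 0 < r ∧ S = Metric.closedBall x r}

theorem closedBall_mem_closedBalls (x : X) {r : ℝ} (hr : 0 < r) :
    Metric.closedBall x r ∈ closedBalls X := Or.inr ⟨x, r, hr, rfl⟩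

theorem isOpen_of_mem_closedBalls {S : Set X} (hS : S ∈ closedBalls X) : IsOpen S := by
  rcases hS with rfl | ⟨x, r, hr, rfl⟩
  · exact isOpen_empty
  · exact IsUltrametricDist.isOpen_closedBall x hr.ne'

theorem isCompact_of_mem_closedBalls [ProperSpace X] {S : Set X} (hS : S ∈ closedBalls X) :
    IsCompact S := by
  rcases hS with rfl | ⟨x, r, hr, rfl⟩
  · exact isCompact_empty
  · exact isCompact_closedBall x r

theorem isSetSemiring_closedBalls [ProperSpace X] : IsSetSemiring (closedBalls X) := by
  classical
  refine ⟨Or.inl rfl, ?_, ?_⟩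
  · intro s hs t ht
    rcases (s ∩ t).eq_empty_or_nonempty with he | ⟨z, hzs, hzt⟩
    · exact Or.inl he
    rcases hs with rfl | ⟨x, r, hr, rfl⟩
    · exact absurd hzs (Set.notMem_empty z)
    rcases ht with rfl | ⟨y, r', hr', rfl⟩
    · exact absurd hzt (Set.notMem_empty z)
    refine Or.inr ⟨z, min r r', lt_min hr hr', ?_⟩
    rw [IsUltrametricDist.closedBall_eq_of_mem hzs, IsUltrametricDist.closedBall_eq_of_mem hzt]
    ext w
    simp
  · intro s hs t ht
    rcases hs with rfl | ⟨x, r, hr, rfl⟩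
    · exact ⟨∅, by simp, by simp, by simp⟩
    rcases ht with rfl | ⟨y, r', hr', rfl⟩
    · exact ⟨{Metric.closedBall x r}, by simpa using closedBall_mem_closedBalls x hr, by simp,
        by simp⟩
    -- Balls of the smaller radius around points of the difference lie in the first ball and miss
    -- the second; compactness leaves finitely many of them.
    set ρ := min r r' with hρ
    have hρ0 : 0 < ρ := lt_min hr hr'
    set A : Set (Set X) :=
      (fun z => Metric.closedBall z ρ) '' (Metric.closedBall x r \ Metric.closedBall y r') with hA
    have hfin : A.Finite := by
      obtain ⟨T, -, hTf, hT⟩ := (isCompact_closedBall x r).finite_cover_balls hρ0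
      refine (hTf.image fun z => Metric.closedBall z ρ).subset ?_
      rintro _ ⟨z, hz, rfl⟩
      obtain ⟨w, hw, hzw⟩ := Set.mem_iUnion₂.mp (hT hz.1)
      exact ⟨w, hw, IsUltrametricDist.closedBall_eq_of_mem (Metric.ball_subset_closedBall hzw)⟩
    refine ⟨hfin.toFinset, ?_, ?_, ?_⟩
    · rw [hfin.coe_toFinset]
      rintro _ ⟨z, hz, rfl⟩
      exact closedBall_mem_closedBalls z hρ0
    · rw [hfin.coe_toFinset]
      rintro _ ⟨z, hz, rfl⟩ _ ⟨w, hw, rfl⟩ hne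
      exact (IsUltrametricDist.closedBall_eq_or_disjoint z w ρ).resolve_left hne
    · rw [hfin.coe_toFinset]
      ext w
      constructor
      · exact fun hw => ⟨_, ⟨w, hw, rfl⟩, Metric.mem_closedBall_self hρ0.le⟩
      · rintro ⟨_, ⟨z, hz, rfl⟩, hw⟩
        have hw1 : w ∈ Metric.closedBall z r :=
          Metric.closedBall_subset_closedBall (min_le_left _ _) hw
        have hw2 : w ∈ Metric.closedBall z r' :=
          Metric.closedBall_subset_closedBall (min_le_right _ _) hw
        refine ⟨?_, fun hwy => hz.2 ?_⟩
        · rwa [IsUltrametricDist.closedBall_eq_of_mem hz.1]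
        · rw [IsUltrametricDist.closedBall_eq_of_mem hwy]
          exact Metric.mem_closedBall_comm.mp hw2

theorem borel_eq_generateFrom_closedBalls [ProperSpace X] [m : MeasurableSpace X] [BorelSpace X] :
    m = MeasurableSpace.generateFrom (closedBalls X) := by
  rw [BorelSpace.measurable_eq (α := X)]
  refine TopologicalSpace.IsTopologicalBasis.borel_eq_generateFrom
    (TopologicalSpace.isTopologicalBasis_of_isOpen_of_nhds
      (fun S hS => isOpen_of_mem_closedBalls hS) fun x U hx hU => ?_)
  obtain ⟨r, hr, hrU⟩ := Metric.nhds_basis_closedBall.mem_iff.mp (hU.mem_nhds hx)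
  exact ⟨_, closedBall_mem_closedBalls x hr, Metric.mem_closedBall_self hr.le, hrU⟩

variable [ProperSpace X] [MeasurableSpace X] [BorelSpace X]

theorem measure_ext_of_closedBall {μ ν : Measure X}
    (hfin : ∀ (x : X) (r : ℝ), 0 < r → μ (Metric.closedBall x r) ≠ ⊤)
    (h : ∀ (x : X) (r : ℝ), 0 < r → μ (Metric.closedBall x r) = ν (Metric.closedBall x r)) :
    μ = ν := by
  rcases isEmpty_or_nonempty X with hX | ⟨⟨x⟩⟩
  · rw [Measure.eq_zero_of_isEmpty μ, Measure.eq_zero_of_isEmpty ν]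
  refine Measure.ext_of_generateFrom_of_iUnion (closedBalls X)
    (fun n : ℕ => Metric.closedBall x ((n : ℝ) + 1)) borel_eq_generateFrom_closedBalls
    (fun s hs t ht _ => isSetSemiring_closedBalls.inter_mem s hs t ht) ?_
    (fun n => closedBall_mem_closedBalls x (by positivity)) (fun n => hfin _ _ (by positivity)) ?_
  · refine Set.eq_univ_of_forall fun y => ?_
    obtain ⟨n, hn⟩ := exists_nat_ge (dist y x)
    exact Set.mem_iUnion.mpr ⟨n, Metric.mem_closedBall.mpr (by linarith)⟩
  · rintro _ (rfl | ⟨y, r, hr, rfl⟩)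
    · simp
    · exact h y r hr

/-- A function on the closed balls of a proper ultrametric space that agrees on every finite family
of balls with some measure comes from a measure. -/
theorem exists_measure_closedBall (N : X → ℝ → ℝ≥0∞)
    (H : ∀ I : Finset (X × ℝ), (∀ i ∈ I, 0 < i.2) →
      ∃ ν : Measure X, ∀ i ∈ I, ν (Metric.closedBall i.1 i.2) = N i.1 i.2) :
    ∃ μ : Measure X, ∀ (x : X) (r : ℝ), 0 < r → μ (Metric.closedBall x r) = N x r := by
  classical
  rcases isEmpty_or_nonempty X with hX | ⟨⟨x₀⟩⟩
  · exact ⟨0, fun x => hX.elim x⟩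
  -- A set can be a ball for many centres and radii, so one representation is chosen; the hypothesis
  -- on finite families later shows the choice to be irrelevant.
  have hrep : ∀ S : Set X, ∃ i : X × ℝ, (∃ (x : X) (r : ℝ), 0 < r ∧ S = Metric.closedBall x r) →
      0 < i.2 ∧ S = Metric.closedBall i.1 i.2 := fun S => by
    by_cases h : ∃ (x : X) (r : ℝ), 0 < r ∧ S = Metric.closedBall x r
    · obtain ⟨x, r, hr⟩ := h
      exact ⟨(x, r), fun _ => hr⟩
    · exact ⟨(x₀, 1), fun h' => absurd h' h⟩
  choose rep hrep using hrep
  set m : Set X → ℝ≥0∞ := fun S => if S.Nonempty then N (rep S).1 (rep S).2 else 0 with hm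
  have hrep' : ∀ S ∈ closedBalls X, S.Nonempty →
      0 < (rep S).2 ∧ S = Metric.closedBall (rep S).1 (rep S).2 := fun S hS hne =>
    hrep S (hS.resolve_left hne.ne_empty)
  have key : ∀ T : Finset (Set X), (∀ S ∈ T, S ∈ closedBalls X) →
      ∃ ν : Measure X, ∀ S ∈ T, ν S = m S := by
    intro T hT
    obtain ⟨ν, hν⟩ := H ((T.filter Set.Nonempty).image rep) (by
      intro i hi
      obtain ⟨S, hS, rfl⟩ := Finset.mem_image.mp hi
      rw [Finset.mem_filter] at hS
      exact (hrep' S (hT S hS.1) hS.2).1)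
    refine ⟨ν, fun S hS => ?_⟩
    by_cases hne : S.Nonempty
    · simp only [hm, if_pos hne]
      rw [← hν (rep S) (Finset.mem_image_of_mem _ (Finset.mem_filter.mpr ⟨hS, hne⟩)),
        ← (hrep' S (hT S hS) hne).2]
    · simp only [hm, if_neg hne]
      rw [Set.not_nonempty_iff_eq_empty.mp hne, measure_empty]
  let mc : AddContent ℝ≥0∞ (closedBalls X) :=
    { toFun := m
      empty' := by simp [hm]
      sUnion' := by
        intro I hI hd hU
        obtain ⟨ν, hν⟩ := key (insert (⋃₀ ↑I) I) (by
          intro S hS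
          rcases Finset.mem_insert.mp hS with rfl | hS
          · exact hU
          · exact hI hS)
        rw [← hν _ (Finset.mem_insert_self _ _), Set.sUnion_eq_biUnion]
        simp only [Finset.mem_coe]
        rw [measure_biUnion_finset (f := fun S => S) hd fun S hS =>
          (isOpen_of_mem_closedBalls (hI hS)).measurableSet]
        exact Finset.sum_congr rfl fun S hS => hν S (Finset.mem_insert_of_mem hS) }
  -- A ball is compact and its pieces are open, so countable subadditivity reduces to a finite
  -- subcover, on which a genuine measure takes the prescribed values.
  have hσ : mc.IsSigmaSubadditive := by
    intro f hf hU
    obtain ⟨t, ht⟩ := (isCompact_of_mem_closedBalls hU).elim_finite_subcover f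
      (fun i => isOpen_of_mem_closedBalls (hf i)) subset_rfl
    obtain ⟨ν, hν⟩ := key (insert (⋃ i, f i) (t.image f)) (by
      intro S hS
      rcases Finset.mem_insert.mp hS with rfl | hS
      · exact hU
      · obtain ⟨i, -, rfl⟩ := Finset.mem_image.mp hS
        exact hf i)
    calc m (⋃ i, f i) = ν (⋃ i, f i) := (hν _ (Finset.mem_insert_self _ _)).symm
      _ ≤ ν (⋃ i ∈ t, f i) := measure_mono ht
      _ ≤ ∑ i ∈ t, ν (f i) := measure_biUnion_finset_le _ _
      _ = ∑ i ∈ t, m (f i) := Finset.sum_congr rfl fun i hi =>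
          hν _ (Finset.mem_insert_of_mem (Finset.mem_image_of_mem f hi))
      _ ≤ ∑' i, m (f i) := ENNReal.sum_le_tsum _
  refine ⟨mc.measure isSetSemiring_closedBalls borel_eq_generateFrom_closedBalls.le hσ,
    fun x r hr => ?_⟩
  have hmem := closedBall_mem_closedBalls x hr
  have hne : (Metric.closedBall x r).Nonempty := ⟨x, Metric.mem_closedBall_self hr.le⟩
  obtain ⟨h1, h2⟩ := hrep' _ hmem hne
  rw [AddContent.measure_eq _ _ borel_eq_generateFrom_closedBalls _ hmem]
  change m _ = _
  simp only [hm, if_pos hne]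
  -- One measure matches both representations of this ball, so the two prescribed values coincide.
  obtain ⟨ν, hν⟩ := H {(x, r), rep (Metric.closedBall x r)} (by
    intro i hi
    rcases Finset.mem_insert.mp hi with rfl | hi
    · exact hr
    · rw [Finset.mem_singleton.mp hi]
      exact h1)
  rw [← hν (rep (Metric.closedBall x r)) (by simp), ← h2, hν (x, r) (by simp)]

end UltrametricMeasure

/-! ### The measure on the zero set -/

section ZeroMeasure

open Polynomial

variable {p : ℕ} [hp : Fact p.Prime] {F : Type*} [NormedField F] [IsUltrametricDist F]
  [CompleteSpace F] [CharP F p] [PerfectRing F p] [IsAlgClosed F]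

theorem HasCount.eventually {b : Exponent p → F} {α : F} {r : ℝ} {N : ℝ≥0∞}
    (h : HasCount b α r N) : ∀ᶠ R in atTop, ∀ᶠ ε in 𝓝[>] (0 : ℝ), ∀ (n : ℕ) (Q : F[X]),
      Approx b R ε n Q → (rootCount Q α r : ℝ≥0∞) / (p : ℝ≥0∞) ^ n = N := by
  obtain ⟨R₀, ε₀, -, hε₀, H⟩ := h.forall_approx
  filter_upwards [eventually_ge_atTop R₀] with R hR
  filter_upwards [Ioc_mem_nhdsGT hε₀] with ε hε
  exact H R ε hR hε.1.le hε.2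

theorem properSpace_zeros {b : Exponent p → F} (hb : b ∈ seriesP p F) (h0 : b ≠ 0) {X : Set F}
    (hX : ∀ z, z ∈ X ↔ eval p b z = 0) : ProperSpace X := by
  refine ⟨fun x r => ?_⟩
  rw [Subtype.isCompact_iff]
  refine (isCompact_zeros_inter_closedBall hb h0 (‖(x : F)‖ + r)).of_isClosed_subset ?_ ?_
  · have hclosed : IsClosed X := by
      have : X = {z | eval p b z = 0} := Set.ext hX
      rw [this]
      exact isClosed_eq (continuous_eval hb) continuous_const
    exact hclosed.isClosedMap_subtype_val _ Metric.isClosed_closedBall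
  · rintro _ ⟨z, hz, rfl⟩
    refine ⟨(hX _).mp z.2, ?_⟩
    rw [Metric.mem_closedBall, Subtype.dist_eq, dist_eq_norm] at hz
    have := norm_add_le (x : F) ((z : F) - x)
    rw [add_sub_cancel] at this
    linarith

theorem mem_closedBall_congr {α x y : F} {δ r : ℝ} (h : dist x y ≤ δ) (hδ : δ ≤ r) :
    x ∈ Metric.closedBall α r ↔ y ∈ Metric.closedBall α r := by
  constructor <;> intro h'
  · exact (dist_triangle_max y x α).trans (max_le ((dist_comm y x ▸ h).trans hδ) h')
  · exact (dist_triangle_max x y α).trans (max_le (h.trans hδ) h')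

/-- One approximation good enough for all the discs is taken; each of its roots in the large disc is
moved to a nearby zero and carries its multiplicity divided by `p ^ n`. -/
theorem exists_measure_finset [MeasurableSpace F] [BorelSpace F] {b : Exponent p → F}
    (hb : b ∈ seriesP p F) (h0 : b ≠ 0) {X : Set F} (hX : ∀ z, z ∈ X ↔ eval p b z = 0)
    (I : Finset (F × ℝ)) (N : F × ℝ → ℝ≥0∞) (hI : ∀ i ∈ I, 0 < i.2)
    (hN : ∀ i ∈ I, HasCount b i.1 i.2 (N i)) :
    ∃ ν : Measure X, ∀ i ∈ I, ν {z | (z : F) ∈ Metric.closedBall i.1 i.2} = N i := by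
  classical
  -- With `δ` at most every radius, moving a root by `δ` cannot take it into or out of any of the
  -- discs.
  obtain ⟨δ, hδ0, hδ⟩ : ∃ δ : ℝ, 0 < δ ∧ ∀ i ∈ I, δ ≤ i.2 := by
    have h1 : ∀ᶠ δ in 𝓝[>] (0 : ℝ), ∀ i ∈ I, δ ≤ i.2 := (Filter.eventually_all_finset I).mpr
      fun i hi => by
        filter_upwards [Ioc_mem_nhdsGT (hI i hi)] with δ hδ using hδ.2
    obtain ⟨δ, h2, h3⟩ := (h1.and self_mem_nhdsWithin).exists
    exact ⟨δ, h3, h2⟩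
  obtain ⟨R, hR, hδR⟩ := (((Filter.eventually_all_finset I).mpr fun i hi =>
    ((hN i hi).eventually.and ((eventually_ge_atTop ‖i.1‖).and
      (eventually_ge_atTop i.2)))).and (eventually_ge_atTop δ)).exists
  obtain ⟨l, hl, hroot⟩ := exists_forall_approx_roots hb h0 hδ0 hδR
  obtain ⟨ε, hε1, hε2, hεl⟩ := (((Filter.eventually_all_finset I).mpr fun i hi =>
    (hR i hi).1).and (Ioo_mem_nhdsGT hl)).exists
  obtain ⟨n, Q, hQ⟩ := exists_approx hb (hδ0.le.trans hδR) hε2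
  obtain ⟨-, -, hz⟩ := hroot ε n Q hε2.le hεl hQ
  choose! ξ hξ0 hξ using hz
  set S : Finset F := Q.roots.toFinset.filter (‖·‖ ≤ R) with hS
  have hS' : ∀ y ∈ S, y ∈ Q.roots ∧ ‖y‖ ≤ R := fun y hy => by simpa [hS] using hy
  let ξ' : S → X := fun y => ⟨ξ y, (hX _).mpr (hξ0 y (hS' y y.2).1 (hS' y y.2).2)⟩
  refine ⟨∑ y : S, ((Q.roots.count (y : F) : ℝ≥0∞) / (p : ℝ≥0∞) ^ n) • Measure.dirac (ξ' y),
    fun i hi => ?_⟩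
  have hmeas : MeasurableSet {z : X | (z : F) ∈ Metric.closedBall i.1 i.2} :=
    measurable_subtype_coe measurableSet_closedBall
  rw [← hε1 i hi n Q hQ, rootCount_eq_sum, Measure.finsetSum_apply]
  simp only [Measure.smul_apply, Measure.dirac_apply' _ hmeas, smul_eq_mul]
  have hterm : ∀ y : S, (Q.roots.count (y : F) : ℝ≥0∞) / (p : ℝ≥0∞) ^ n *
      Set.indicator {z : X | (z : F) ∈ Metric.closedBall i.1 i.2} 1 (ξ' y) =
      ((if (y : F) ∈ Metric.closedBall i.1 i.2 then Q.roots.count (y : F) else 0 : ℕ) : ℝ≥0∞) /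
        (p : ℝ≥0∞) ^ n := fun y => by
    have hiff : ξ' y ∈ {z : X | (z : F) ∈ Metric.closedBall i.1 i.2} ↔
        (y : F) ∈ Metric.closedBall i.1 i.2 :=
      mem_closedBall_congr (hξ y (hS' y y.2).1 (hS' y y.2).2) (hδ i hi)
    by_cases hy : (y : F) ∈ Metric.closedBall i.1 i.2
    · rw [Set.indicator_of_mem (hiff.mpr hy), if_pos hy, Pi.one_apply, mul_one]
    · rw [Set.indicator_of_notMem (mt hiff.mp hy), if_neg hy, mul_zero, Nat.cast_zero,
        ENNReal.zero_div]
  rw [Finset.sum_congr rfl fun y _ => hterm y, Finset.sum_coe_sort S fun y =>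
    ((if y ∈ Metric.closedBall i.1 i.2 then Q.roots.count y else 0 : ℕ) : ℝ≥0∞) /
        (p : ℝ≥0∞) ^ n]
  simp only [div_eq_mul_inv]
  rw [← Finset.sum_mul, ← Nat.cast_sum]
  congr 2
  -- Roots of norm above `R` were discarded, but the discs lie in the disc of radius `R`, so none of
  -- these roots contributes.
  refine Finset.sum_subset (Finset.filter_subset _ _) fun y hy hyS => if_neg fun hyB => hyS ?_
  exact Finset.mem_filter.mpr ⟨hy, norm_le_of_dist_le (hR i hi).2.1 hyB (hR i hi).2.2⟩

theorem exists_zeroMeasure [MeasurableSpace F] [BorelSpace F] {b : Exponent p → F}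
    (hb : b ∈ seriesP p F) (h0 : b ≠ 0) {X : Set F} (hX : ∀ z, z ∈ X ↔ eval p b z = 0) :
    ∃ μ : Measure X, ∀ (α : F) (r : ℝ) (N : ℝ≥0∞), 0 < r → HasCount b α r N →
      μ {z | (z : F) ∈ Metric.closedBall α r} = N := by
  classical
  have := properSpace_zeros hb h0 hX
  choose! N hN using fun (α : F) (r : ℝ) (hr : 0 < r) => exists_hasCount hb h0 α hr
  obtain ⟨μ, hμ⟩ := exists_measure_closedBall (X := X) (fun x r => N x r) (by
    intro I hI
    obtain ⟨ν, hν⟩ := exists_measure_finset hb h0 hX (I.image fun i => ((i.1 : F), i.2))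
      (fun i => N i.1 i.2) (by
        intro i hi
        obtain ⟨j, hj, rfl⟩ := Finset.mem_image.mp hi
        exact hI j hj) (by
        intro i hi
        obtain ⟨j, hj, rfl⟩ := Finset.mem_image.mp hi
        exact hN _ _ (hI j hj))
    exact ⟨ν, fun i hi => hν _ (Finset.mem_image_of_mem _ hi)⟩)
  refine ⟨μ, fun α r M hr hM => ?_⟩
  obtain rfl := hM.unique hb (hN α r hr)
  -- The centre need not be a zero. A disc without zeros has count `0` by the finite case; otherwise
  -- the disc is recentred at a zero.
  rcases {z : X | (z : F) ∈ Metric.closedBall α r}.eq_empty_or_nonempty with he | ⟨x, hx⟩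
  · obtain ⟨ν, hν⟩ := exists_measure_finset hb h0 hX {(α, r)} (fun i => N i.1 i.2)
      (by simpa using hr) (by simpa using hN α r hr)
    rw [← hν (α, r) (by simp), he, measure_empty, measure_empty]
  · have heq : {z : X | (z : F) ∈ Metric.closedBall α r} = Metric.closedBall x r := by
      rw [IsUltrametricDist.closedBall_eq_of_mem (show (x : F) ∈ Metric.closedBall α r from hx)]
      rfl
    obtain ⟨ν, hν⟩ := exists_measure_finset hb h0 hX {(α, r), ((x : F), r)} (fun i => N i.1 i.2)
      (by simpa using hr) (by simpa using ⟨hN α r hr, hN x r hr⟩)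
    rw [heq, hμ x r hr, ← hν (α, r) (by simp), ← hν ((x : F), r) (by simp)]
    change ν {z : X | (z : F) ∈ _} = ν {z : X | (z : F) ∈ _}
    rw [heq]
    rfl

end ZeroMeasure

/-! ### Ordinary power series: counts as multiplicities -/

section

open Polynomial

section Ordinary

variable {p : ℕ} [hp : Fact p.Prime] {F : Type*} [NormedField F] [IsUltrametricDist F]
  [CompleteSpace F] [CharP F p] [PerfectRing F p]

theorem ofNat_injective (p : ℕ) [Fact p.Prime] : Function.Injective (Exponent.ofNat p) :=
    fun i j h => by
  have : (Exponent.ofNat p i).val = (Exponent.ofNat p j).val := by rw [h]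
  rw [Exponent.val_ofNat, Exponent.val_ofNat] at this
  exact_mod_cast this

theorem termNorm_ofNat (b : Exponent p → F) (R : ℝ) (j : ℕ) :
    termNorm b R (Exponent.ofNat p j) = ‖b (Exponent.ofNat p j)‖ * R ^ j := by
  rw [termNorm, Exponent.val_ofNat, Rat.cast_natCast, Real.rpow_natCast]

theorem exists_approx_zero_of_isOrdinary {b : Exponent p → F} (hb : b ∈ seriesP p F)
    (hord : IsOrdinary p b) {R ε : ℝ} (hR : 0 ≤ R) (hε : 0 < ε) : ∃ Q : F[X], Approx b R ε 0 Q := by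
  refine exists_approx_of_termNorm_le hb hR hε fun e he => ?_
  by_cases h : b e = 0
  · rw [termNorm, h, norm_zero, zero_mul]
    exact hε.le
  · obtain ⟨m, hm⟩ := hord e h
    exact absurd (by simpa using hm) (he m)

theorem norm_choose_mul_le (m k : ℕ) (x y : F) {R : ℝ} (hx : ‖x‖ ≤ R) :
    ‖((k + m).choose m : F) * y * x ^ k‖ * R ^ m ≤ ‖y‖ * R ^ (k + m) := by
  have hR : 0 ≤ R := (norm_nonneg x).trans hx
  rw [norm_mul, norm_mul, norm_pow, pow_add, ← mul_assoc]
  gcongr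
  exact mul_le_of_le_one_left (norm_nonneg y) (IsUltrametricDist.norm_natCast_le_one F _)

/-- Re-expansion is linear in the coefficients and involves only binomial factors of norm at most
`1`, so closeness of the coefficients passes to the expansions at `x`. -/
theorem norm_coeff_expandAt_sub_le {b : Exponent p → F} (hb : b ∈ seriesP p F) {R ε : ℝ}
    (hR : 0 < R) (hε : 0 ≤ ε) {Q : F[X]} (h : Approx b R ε 0 Q) {x : F} (hx : ‖x‖ ≤ R) (m : ℕ) :
    ‖PowerSeries.coeff m (expandAt (toPowerSeries p b) x) - (taylor x Q).coeff m‖ * R ^ m ≤ ε := by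
  have hRm : 0 < R ^ m := by positivity
  have hcoef : ∀ j, ‖b (Exponent.ofNat p j) - Q.coeff j‖ * R ^ j ≤ ε := fun j => by
    have := h.coeff_le (Exponent.ofNat p j) j (by simp [Exponent.val_ofNat])
    rw [norm_sub_rev]
    simpa using this
  have hsum : Summable fun k : ℕ => ((k + m).choose m : F) * b (Exponent.ofNat p (k + m)) *
      x ^ k := by
    refine NonarchimedeanAddGroup.summable_of_tendsto_cofinite_zero ?_
    have h1 : Tendsto (fun k : ℕ => termNorm b R (Exponent.ofNat p (k + m)) * (R ^ m)⁻¹) cofinite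
        (𝓝 (0 * (R ^ m)⁻¹)) :=
      ((tendsto_termNorm hb hR.le).comp (((ofNat_injective p).comp
        (add_left_injective m)).tendsto_cofinite)).mul_const _
    rw [zero_mul] at h1
    refine squeeze_zero_norm (fun k => ?_) h1
    rw [← div_eq_mul_inv, le_div_iff₀ hRm, termNorm_ofNat]
    exact norm_choose_mul_le m k x _ hx
  have hQ : HasSum (fun k : ℕ => ((k + m).choose m : F) * Q.coeff (k + m) * x ^ k)
      ((taylor x Q).coeff m) := by
    rw [taylor_coeff, eval_eq_sum_range]
    simp_rw [hasseDeriv_coeff]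
    refine hasSum_sum_of_ne_finset_zero fun k hk => ?_
    have : (hasseDeriv m Q).coeff k = 0 :=
      coeff_eq_zero_of_natDegree_lt (by simpa [Nat.lt_succ_iff] using hk)
    rw [hasseDeriv_coeff] at this
    rw [this, zero_mul]
  rw [expandAt, PowerSeries.coeff_mk]
  simp only [toPowerSeries, PowerSeries.coeff_mk]
  rw [← hQ.tsum_eq, ← hsum.tsum_sub hQ.summable, ← le_div_iff₀ hRm]
  refine IsUltrametricDist.norm_tsum_le_of_forall_le_of_nonneg (by positivity) fun k => ?_
  rw [← sub_mul, ← mul_sub, le_div_iff₀ hRm]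
  exact (norm_choose_mul_le m k x _ hx).trans (hcoef _)

variable [IsAlgClosed F]

/-- With `m` the order of the expansion at `x`, the term of index `m` dominates on every small
enough disc. This passes to level-zero approximations, which then have exactly `m` roots there. -/
theorem exists_zeroMultiplicity_eq {b : Exponent p → F} (hb : b ∈ seriesP p F) (h0 : b ≠ 0)
    (hord : IsOrdinary p b) (x : F) :
    ∃ (m : ℕ) (ρ₀ : ℝ), 0 < ρ₀ ∧ zeroMultiplicity (toPowerSeries p b) x = m ∧
      ∀ ρ, 0 < ρ → ρ ≤ ρ₀ → HasCount b x ρ m := by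
  classical
  set B := fun j => PowerSeries.coeff j (expandAt (toPowerSeries p b) x) with hB
  set R : ℝ := ‖x‖ + 1 with hRdef
  have hR : 0 < R := by positivity
  have hxR : ‖x‖ ≤ R := by linarith
  obtain ⟨l, hl, H⟩ := exists_discNorm_lower_bound hb h0 hR le_rfl
  have hlink : ∀ {ε : ℝ} {Q : F[X]}, 0 ≤ ε → Approx b R ε 0 Q → ∀ j,
      ‖B j - (taylor x Q).coeff j‖ * R ^ j ≤ ε := fun hε hQ j =>
    norm_coeff_expandAt_sub_le hb hR hε hQ hxR j
  obtain ⟨Q, hQ⟩ := exists_approx_zero_of_isOrdinary hb hord hR.le (half_pos hl)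
  obtain ⟨hQ0, hlow⟩ := H _ _ _ (half_pos hl).le (half_lt_self hl) hQ
  have hdom := isDominant_taylor hQ0 x hR
  have hlow' : l ≤ discNorm Q x R := by simpa using hlow x hxR
  -- The dominant coefficient of the approximation has size at least `l`, while the error is at most
  -- `l / 2`.
  have hex : ∃ j, B j ≠ 0 := by
    refine ⟨rootCount Q x R, fun h => ?_⟩
    have h1 := hlink (half_pos hl).le hQ (rootCount Q x R)
    rw [h, zero_sub, norm_neg, hdom.eq] at h1
    linarith
  set m := Nat.find hex with hm
  have hBm : B m ≠ 0 := Nat.find_spec hex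
  have hBm' : 0 < ‖B m‖ := norm_pos_iff.mpr hBm
  have hBlt : ∀ j < m, B j = 0 := fun j hj => not_not.mp (Nat.find_min hex hj)
  set M : ℝ := discNorm Q x R + l / 2 with hM
  have hMpos : 0 < M := by linarith
  have hBle : ∀ j, ‖B j‖ * R ^ j ≤ M := fun j => by
    have h1 := norm_add_le (B j - (taylor x Q).coeff j) ((taylor x Q).coeff j)
    rw [sub_add_cancel] at h1
    have h2 := hlink (half_pos hl).le hQ j
    have h3 := hdom.le j
    have h4 : (0 : ℝ) ≤ R ^ j := by positivity
    nlinarith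
  -- `M + 1` bounds the coefficients of every approximation with error at most `1`; the factor `2`
  -- makes the `m`-th term strictly dominate the later ones.
  have hρ₀ : 0 < min R (‖B m‖ * R ^ (m + 1) / (2 * (M + 1))) := by positivity
  refine ⟨m, min R (‖B m‖ * R ^ (m + 1) / (2 * (M + 1))), hρ₀, ?_, fun ρ hρ hρle => ?_⟩
  · rw [zeroMultiplicity, PowerSeries.order_eq_nat]
    exact ⟨hBm, hBlt⟩
  have hρR : ρ ≤ R := hρle.trans (min_le_left _ _)
  have hρ1 : (M + 1) * ρ < ‖B m‖ * R ^ (m + 1) := by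
    have h1 := hρle.trans (min_le_right _ _)
    rw [le_div_iff₀ (by positivity)] at h1
    have : 0 < (M + 1) * ρ := by positivity
    linarith
  have hkey : (M + 1) * (ρ / R) ^ (m + 1) < ‖B m‖ * ρ ^ m := by
    rw [div_pow, ← mul_div_assoc, div_lt_iff₀ (by positivity), pow_succ ρ]
    calc (M + 1) * (ρ ^ m * ρ) = ρ ^ m * ((M + 1) * ρ) := by ring
      _ < ρ ^ m * (‖B m‖ * R ^ (m + 1)) := by gcongr
      _ = _ := by ring
  obtain ⟨N, hN⟩ := exists_hasCount hb h0 x hρ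
  obtain ⟨R', ε', hR', hε', hcount⟩ := hN.forall_approx
  have hε : 0 < min ε' (min 1 (‖B m‖ * ρ ^ m / 2)) := by positivity
  -- The radius and error must serve both the count on the disc of radius `ρ` and the comparison
  -- with the expansion `B`.
  obtain ⟨Q', hQ'⟩ := exists_approx_zero_of_isOrdinary hb hord (hR.le.trans (le_max_left R R')) hε
  have hNQ := hcount _ _ (le_max_right R R') hε.le (min_le_left _ _) 0 Q' hQ'
  have hT := hlink hε.le (hQ'.mono hR.le (le_max_left _ _) hε.le le_rfl)
  have hε1 : min ε' (min 1 (‖B m‖ * ρ ^ m / 2)) ≤ 1 := (min_le_right _ _).trans (min_le_left _ _)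
  have hε2 : min ε' (min 1 (‖B m‖ * ρ ^ m / 2)) < ‖B m‖ * ρ ^ m :=
    ((min_le_right _ _).trans (min_le_right _ _)).trans_lt (half_lt_self (by positivity))
  have hTm : ‖(taylor x Q').coeff m‖ = ‖B m‖ := by
    refine norm_eq_of_norm_sub_lt (lt_of_mul_lt_mul_right (a := R ^ m) ?_ (by positivity))
    refine ((hT m).trans_lt hε2).trans_le ?_
    gcongr
  have hTlt : ∀ j < m, ‖(taylor x Q').coeff j‖ * ρ ^ j < ‖B m‖ * ρ ^ m := fun j hj => by
    have h1 := hT j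
    rw [hBlt j hj, zero_sub, norm_neg] at h1
    refine lt_of_le_of_lt ?_ (h1.trans_lt hε2)
    gcongr
  have hTgt : ∀ j, m < j → ‖(taylor x Q').coeff j‖ * ρ ^ j < ‖B m‖ * ρ ^ m := fun j hj => by
    refine lt_of_le_of_lt ?_ hkey
    have h1 : ‖(taylor x Q').coeff j‖ * R ^ j ≤ M + 1 := by
      have h1 := norm_sub_le (B j) (B j - (taylor x Q').coeff j)
      rw [sub_sub_cancel] at h1
      have h2 := hT j
      have h3 := hBle j
      have h4 : (0 : ℝ) ≤ R ^ j := by positivity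
      nlinarith
    have h2 : (ρ / R) ^ j ≤ (ρ / R) ^ (m + 1) :=
      pow_le_pow_of_le_one (by positivity) ((div_le_one hR).mpr hρR) hj
    calc ‖(taylor x Q').coeff j‖ * ρ ^ j = ‖(taylor x Q').coeff j‖ * R ^ j * (ρ / R) ^ j := by
          rw [div_pow, mul_assoc, mul_div_cancel₀ _ (by positivity)]
      _ ≤ (M + 1) * (ρ / R) ^ (m + 1) := by gcongr
  have hdom' : IsDominant (taylor x Q') ρ (‖B m‖ * ρ ^ m) m :=
    ⟨by positivity, fun j => by
      rcases lt_trichotomy j m with h | rfl | h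
      · exact (hTlt j h).le
      · rw [hTm]
      · exact (hTgt j h).le, by rw [hTm], hTgt⟩
  have hQ'0 : Q' ≠ 0 := by
    rintro rfl
    exact hdom'.ne_zero (map_zero _)
  rw [((isDominant_taylor hQ'0 x hρ).unique hdom').2, pow_zero, div_one] at hNQ
  rwa [hNQ]

variable [MeasurableSpace F] [BorelSpace F]

/-- Small balls around a zero all have the same finite mass `m`, whereas a second zero nearby would
add positive mass. So zeros are isolated, and the measure is a countable sum of atoms. -/
theorem zeroMeasure_eq_tsum {b : Exponent p → F} (hb : b ∈ seriesP p F) (h0 : b ≠ 0)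
    (hord : IsOrdinary p b) {X : Set F} (hX : ∀ z, z ∈ X ↔ eval p b z = 0) {μ : Measure X}
    (hμ : ∀ (α : F) (r : ℝ) (N : ℝ≥0∞), 0 < r → HasCount b α r N →
      μ {z | (z : F) ∈ Metric.closedBall α r} = N) (S : Set X) :
    μ S = ∑' z : S, (zeroMultiplicity (toPowerSeries p b) ((z : X) : F) : ℝ≥0∞) := by
  have := properSpace_zeros hb h0 hX
  have key : ∀ x : X, ∃ ρ > 0, Metric.closedBall x ρ = {x} ∧
      μ {x} = zeroMultiplicity (toPowerSeries p b) (x : F) := by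
    intro x
    obtain ⟨m, ρ₀, hρ₀, hm, hcount⟩ := exists_zeroMultiplicity_eq hb h0 hord x
    have hball : ∀ (y : X) (r : ℝ) (N : ℝ≥0∞), 0 < r → HasCount b (y : F) r N →
        μ (Metric.closedBall y r) = N := fun y => hμ y
    have hsing : Metric.closedBall x ρ₀ = {x} := by
      refine Set.Subset.antisymm (fun z hz => ?_)
        (Set.singleton_subset_iff.mpr (Metric.mem_closedBall_self hρ₀.le))
      by_contra hzx
      have hd : 0 < dist z x := dist_pos.mpr hzx
      have hd' : dist z x ≤ ρ₀ := hz
      have h1 := hball x ρ₀ m hρ₀ (hcount ρ₀ hρ₀ le_rfl)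
      have h2 := hball x (dist z x / 2) m (half_pos hd) (hcount _ (half_pos hd) (by linarith))
      obtain ⟨N, hN⟩ := exists_hasCount hb h0 (z : F) (half_pos hd)
      have h3 := hball z _ N (half_pos hd) hN
      have hN0 := hN.ne_zero hb h0 ((hX _).mp z.2) (half_pos hd)
      have hdisj : Disjoint (Metric.closedBall x (dist z x / 2))
          (Metric.closedBall z (dist z x / 2)) := by
        refine (IsUltrametricDist.closedBall_eq_or_disjoint _ _ _).resolve_left fun heq => ?_
        have : z ∈ Metric.closedBall x (dist z x / 2) := by
          rw [heq]
          exact Metric.mem_closedBall_self (half_pos hd).le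
        rw [Metric.mem_closedBall] at this
        linarith
      have hsub : Metric.closedBall x (dist z x / 2) ∪ Metric.closedBall z (dist z x / 2) ⊆
          Metric.closedBall x ρ₀ := by
        refine Set.union_subset (Metric.closedBall_subset_closedBall (by linarith)) ?_
        rw [IsUltrametricDist.closedBall_eq_of_mem hz]
        exact Metric.closedBall_subset_closedBall (by linarith)
      have h4 := measure_mono (μ := μ) hsub
      rw [measure_union hdisj Metric.isClosed_closedBall.measurableSet, h1, h2, h3] at h4
      exact absurd h4 (not_le.mpr (ENNReal.lt_add_right (ENNReal.natCast_ne_top m) hN0))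
    refine ⟨ρ₀, hρ₀, hsing, ?_⟩
    rw [hm, ← hsing, hball x ρ₀ m hρ₀ (hcount ρ₀ hρ₀ le_rfl)]
    simp
  have hdisc : DiscreteTopology X := by
    rw [discreteTopology_iff_isOpen_singleton]
    intro x
    obtain ⟨ρ, hρ, h1, -⟩ := key x
    rw [← h1]
    exact IsUltrametricDist.isOpen_closedBall x hρ.ne'
  have hcount : Countable X := TopologicalSpace.separableSpace_iff_countable.mp inferInstance
  have h1 : μ (⋃ x ∈ S, {x}) = ∑' x : S, μ {(x : X)} :=
    measure_biUnion S.to_countable (fun x _ y _ hxy => by simpa using hxy)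
      fun x _ => measurableSet_singleton x
  rw [Set.biUnion_of_singleton] at h1
  rw [h1]
  exact tsum_congr fun x => (key x).choose_spec.2.2

theorem numZeros_closedBall {b : Exponent p → F} (hb : b ∈ seriesP p F) (h0 : b ≠ 0)
    (hord : IsOrdinary p b) {α : F} {r : ℝ} (hr : 0 < r) {N : ℝ≥0∞} (hN : HasCount b α r N) :
    numZeros (toPowerSeries p b) (Metric.closedBall α r) = N := by
  set X : Set F := {z | eval p b z = 0} with hXdef
  have hX : ∀ z, z ∈ X ↔ eval p b z = 0 := fun z => Iff.rfl
  obtain ⟨μ, hμ⟩ := exists_zeroMeasure hb h0 hX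
  set g : F → ℝ≥0∞ := fun x => (zeroMultiplicity (toPowerSeries p b) x : ℝ≥0∞) with hg
  -- Off the zero set some small disc contains no zeros, so its mass, which is the multiplicity, is
  -- `0`.
  have hg0 : ∀ x ∉ X, g x = 0 := by
    intro x hx
    obtain ⟨m, ρ₀, hρ₀, hm, hcount⟩ := exists_zeroMultiplicity_eq hb h0 hord x
    have hXc : IsOpen Xᶜ :=
      (isClosed_eq (continuous_eval hb) continuous_const).isOpen_compl
    obtain ⟨ρ, hρ, hsub⟩ := Metric.nhds_basis_closedBall.mem_iff.mp (hXc.mem_nhds hx)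
    have h1 := hμ x (min ρ ρ₀) m (lt_min hρ hρ₀) (hcount _ (lt_min hρ hρ₀) (min_le_right _ _))
    have h2 : {z : X | (z : F) ∈ Metric.closedBall x (min ρ ρ₀)} = ∅ :=
      Set.eq_empty_of_forall_notMem fun z hz =>
        hsub (Metric.closedBall_subset_closedBall (min_le_left _ _) hz) z.2
    rw [h2, measure_empty] at h1
    simp only [hg, hm]
    simpa using h1.symm
  rw [← hμ α r N hr hN, zeroMeasure_eq_tsum hb h0 hord hX hμ, numZeros]
  change ∑' x : Metric.closedBall α r, g x = ∑' z : {z : X | (z : F) ∈ Metric.closedBall α r},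
    (fun z : X => g z) z
  rw [tsum_subtype (Metric.closedBall α r) g,
    tsum_subtype {z : X | (z : F) ∈ Metric.closedBall α r} fun z : X => g z]
  change _ = ∑' z : X, (Metric.closedBall α r).indicator g (z : F)
  rw [tsum_subtype X ((Metric.closedBall α r).indicator g)]
  refine tsum_congr fun x => ?_
  by_cases hx : x ∈ X
  · rw [Set.indicator_of_mem hx]
  · rw [Set.indicator_of_notMem hx]
    by_cases hxB : x ∈ Metric.closedBall α r
    · rw [Set.indicator_of_mem hxB, hg0 x hx]
    · rw [Set.indicator_of_notMem hxB]

end Ordinary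

end

/-! ### Truncations and the defining limit -/

section Truncation

variable {p : ℕ} [hp : Fact p.Prime] {F : Type*} [NormedField F] [CharP F p] [PerfectRing F p]

theorem mem_seriesP_iff {b : Exponent p → F} :
    b ∈ seriesP p F ↔ ∀ z : F, Tendsto (termNorm b ‖z‖) cofinite (𝓝 0) := by
  refine forall_congr' fun z => ?_
  rw [tendsto_zero_iff_norm_tendsto_zero]
  simp only [norm_term]

theorem sub_mem_seriesP {a b : Exponent p → F} (ha : a ∈ seriesP p F) (hb : b ∈ seriesP p F) :
    a - b ∈ seriesP p F := fun z => by
  have := (ha z).sub (hb z)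
  simp only [← sub_mul, sub_zero] at this
  exact this

theorem const_apply_of_ne (c : F) {e : Exponent p} (he : e ≠ Exponent.ofNat p 0) :
    const p c e = 0 :=
  if_neg fun h => he (Exponent.ext (by simpa [Exponent.val_ofNat] using h))

theorem const_apply_zero (c : F) : const p c (Exponent.ofNat p 0) = c :=
  if_pos (by simp [Exponent.val_ofNat])

theorem const_mem_seriesP (c : F) : const p c ∈ seriesP p F := fun z => by
  refine tendsto_const_nhds.congr' ?_
  filter_upwards [(Set.finite_singleton (Exponent.ofNat p 0)).compl_mem_cofinite] with e he
  rw [const_apply_of_ne c he, zero_mul]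

theorem fracPow_zero (z : F) : fracPow p z (Exponent.ofNat p 0) = 1 := by
  have := fracPow_pow_eq z (Exponent.ofNat p 0) 0 0 (by simp [Exponent.val_ofNat])
  simpa using this

theorem eval_sub_const [IsUltrametricDist F] [CompleteSpace F] {a : Exponent p → F}
    (ha : a ∈ seriesP p F) (c z : F) : eval p (a - const p c) z = eval p a z - c := by
  have h1 : ∑' e, const p c e * fracPow p z e = c := by
    rw [tsum_eq_single (Exponent.ofNat p 0) fun e he => by rw [const_apply_of_ne c he, zero_mul],
      const_apply_zero, fracPow_zero, mul_one]
  rw [eval, eval]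
  simp only [Pi.sub_apply, sub_mul]
  rw [(summable_of_mem ha z).tsum_sub (summable_of_mem (const_mem_seriesP c) z), h1]

theorem trunc_mem_seriesP {a : Exponent p → F} (ha : a ∈ seriesP p F) (n : ℕ) :
    trunc p n a ∈ seriesP p F := fun z => by
  refine squeeze_zero_norm (fun e => ?_) (by simpa using (ha z).norm)
  rw [norm_mul]
  gcongr
  unfold trunc
  split_ifs
  · rfl
  · simp

theorem divPow_injective (p : ℕ) [hp : Fact p.Prime] (n : ℕ) :
    Function.Injective fun e : Exponent p => e.divPow n := fun e e' h => by
  have h1 : (e.divPow n).val = (e'.divPow n).val := congrArg _ h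
  rw [Exponent.val_divPow, Exponent.val_divPow, div_left_inj' (natCast_pow_ne_zero p n)] at h1
  exact Exponent.ext h1

theorem frobPow_mem_seriesP {b : Exponent p → F} (hb : b ∈ seriesP p F) (n : ℕ) :
    frobPow p n b ∈ seriesP p F := by
  rw [mem_seriesP_iff] at hb ⊢
  intro z
  have h := ((hb z).comp (divPow_injective p n).tendsto_cofinite).pow (p ^ n)
  rw [zero_pow (pow_ne_zero n hp.out.ne_zero)] at h
  refine h.congr fun e => ?_
  rw [termNorm_frobPow b (norm_nonneg z)]
  rfl

theorem frobPow_ne_zero {b : Exponent p → F} (hb : b ≠ 0) (n : ℕ) : frobPow p n b ≠ 0 := by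
  obtain ⟨e, he⟩ := Function.ne_iff.mp hb
  refine Function.ne_iff.mpr ⟨e.mulPow n, ?_⟩
  rw [frobPow, Exponent.divPow_mulPow]
  exact pow_ne_zero _ he

theorem exists_natCast_of_padicValRat_nonneg (e : Exponent p) (h : 0 ≤ padicValRat p e.val) :
    ∃ m : ℕ, e.val = m := by
  have hden := e.den_eq
  have hd : padicValNat p e.val.den = 0 := by
    by_contra hne
    have hdvd : p ∣ e.val.den := by
      rw [hden]
      exact dvd_pow_self p hne
    have hnum : ¬ (p : ℤ) ∣ e.val.num := fun hdn => by
      have h1 := Nat.dvd_gcd (Int.natCast_dvd.mp hdn) hdvd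
      rw [e.val.reduced.gcd_eq_one] at h1
      exact hp.out.one_lt.ne' (Nat.dvd_one.mp h1)
    rw [padicValRat_def, padicValInt.eq_zero_of_not_dvd hnum] at h
    have : 0 < padicValNat p e.val.den := Nat.pos_of_ne_zero hne
    omega
  rw [hd, pow_zero] at hden
  refine ⟨e.val.num.toNat, ?_⟩
  have h1 : ((e.val.num.toNat : ℕ) : ℤ) = e.val.num :=
    Int.toNat_of_nonneg (Rat.num_nonneg.mpr e.val_nonneg)
  have h2 : ((e.val.num.toNat : ℕ) : ℚ) = (e.val.num : ℚ) := by exact_mod_cast h1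
  rw [h2, Rat.coe_int_num_of_den_eq_one hden]

theorem isOrdinary_frobPow_trunc_sub_const (a : Exponent p → F) (c : F) (n : ℕ) :
    IsOrdinary p (frobPow p n (trunc p n a - const p c)) := by
  intro e he
  by_cases h0 : e.val = 0
  · exact ⟨0, by simpa using h0⟩
  have hp0 : (p : ℚ) ≠ 0 := by exact_mod_cast hp.out.ne_zero
  have hd : (e.divPow n).val ≠ 0 := by
    rw [Exponent.val_divPow]
    exact div_ne_zero h0 (natCast_pow_ne_zero p n)
  have hb : (trunc p n a - const p c) (e.divPow n) ≠ 0 := fun h => he (by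
    rw [frobPow, h, zero_pow (pow_ne_zero n hp.out.ne_zero)])
  rw [Pi.sub_apply, const, if_neg hd, sub_zero, trunc] at hb
  have h1 : (e.divPow n).val = 0 ∨ -(n : ℤ) ≤ padicValRat p (e.divPow n).val := by
    by_contra h
    exact hb (if_neg h)
  have h2 := h1.resolve_left hd
  rw [Exponent.val_divPow, padicValRat.div h0 (natCast_pow_ne_zero p n), padicValRat.pow,
    padicValRat.self hp.out.one_lt] at h2
  exact exists_natCast_of_padicValRat_nonneg e (by omega)

/-- Only finitely many terms reach `ε`, so the valuations of their exponents are bounded below and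
they are all eventually kept. -/
theorem eventually_termNorm_sub_trunc_le {a : Exponent p → F} (ha : a ∈ seriesP p F) (c : F)
    {R ε : ℝ} (hR : 0 ≤ R) (hε : 0 < ε) :
    ∀ᶠ n : ℕ in atTop, ∀ e, termNorm ((a - const p c) - (trunc p n a - const p c)) R e ≤ ε := by
  have hfin : {e | ¬ termNorm a R e < ε}.Finite :=
    (tendsto_termNorm ha hR).eventually (gt_mem_nhds hε)
  obtain ⟨N, hN⟩ := (hfin.image fun e => (-padicValRat p e.val).toNat).bddAbove
  filter_upwards [eventually_ge_atTop N] with n hn e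
  rw [sub_sub_sub_cancel_right, termNorm, Pi.sub_apply, trunc]
  split_ifs with h
  · rw [sub_self, norm_zero, zero_mul]
    exact hε.le
  · rw [sub_zero]
    by_contra! hlt
    push Not at h
    have h1 := hN ⟨e, not_lt.mpr (show ε ≤ termNorm a R e from hlt.le), rfl⟩
    have h2 := h.2
    simp only at h1
    omega

variable [IsUltrametricDist F] [CompleteSpace F] [IsAlgClosed F] [MeasurableSpace F] [BorelSpace F]

theorem sub_const_ne_zero {a : Exponent p → F} (h : ¬ IsConstant p a) (c : F) :
    a - const p c ≠ 0 := by
  unfold IsConstant at h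
  push Not at h
  obtain ⟨e, he, hae⟩ := h
  refine Function.ne_iff.mpr ⟨e, ?_⟩
  rw [Pi.sub_apply, const, if_neg he, sub_zero]
  exact hae

theorem eventually_trunc_sub_const_ne_zero {a : Exponent p → F} (h : ¬ IsConstant p a) (c : F) :
    ∀ᶠ n : ℕ in atTop, trunc p n a - const p c ≠ 0 := by
  unfold IsConstant at h
  push Not at h
  obtain ⟨e, he, hae⟩ := h
  filter_upwards [eventually_ge_atTop (-padicValRat p e.val).toNat] with n hn
  refine Function.ne_iff.mpr ⟨e, ?_⟩
  rw [Pi.sub_apply, const, if_neg he, sub_zero, trunc, if_pos (Or.inr (by omega))]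
  exact hae

/-- For large `n` the truncation is close enough to have the same count `N`, and passing to the `p ^
n`-th power multiplies it by `p ^ n`; the sequence is eventually equal to `N`. -/
theorem tendsto_numZeros {a : Exponent p → F} (ha : a ∈ seriesP p F) (h : ¬ IsConstant p a) (c : F)
    {α : F} {r : ℝ} (hr : 0 < r) {N : ℝ≥0∞} (hN : HasCount (a - const p c) α r N) :
    Tendsto (fun n : ℕ => numZeros (toPowerSeries p (frobPow p n (trunc p n a - const p c)))
      (Metric.closedBall α r) / (p : ℝ≥0∞) ^ n) atTop (𝓝 N) := by
  obtain ⟨R, ε, hR, hε, H⟩ := hN.exists_forall_termNorm_sub_le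
  refine tendsto_const_nhds.congr' ?_
  filter_upwards [eventually_termNorm_sub_trunc_le ha c hR hε,
    eventually_trunc_sub_const_ne_zero h c] with n h1 h2
  have hp0 : (p : ℝ≥0∞) ^ n ≠ 0 := pow_ne_zero _ (by exact_mod_cast hp.out.ne_zero)
  have hpt : (p : ℝ≥0∞) ^ n ≠ ⊤ := ENNReal.pow_ne_top (ENNReal.natCast_ne_top p)
  rw [numZeros_closedBall
    (frobPow_mem_seriesP (sub_mem_seriesP (trunc_mem_seriesP ha n) (const_mem_seriesP c)) n)
    (frobPow_ne_zero h2 n) (isOrdinary_frobPow_trunc_sub_const a c n) hr (H _ h1).frobPow,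
    mul_comm, ENNReal.mul_div_cancel_right hp0 hpt]

end Truncation

/-! ### Newton polygon and total mass -/

section Newton

variable {p : ℕ} [hp : Fact p.Prime] {F : Type*} [NormedField F]

theorem valuation_eq_coe_iff {z : F} {t : ℝ} :
    valuation z = (t : EReal) ↔ z ≠ 0 ∧ -Real.log ‖z‖ = t := by
  unfold valuation
  split_ifs with h
  · simp [h]
  · rw [EReal.coe_eq_coe_iff]
    simp [h]

theorem neg_log_termNorm {b : Exponent p → F} {e : Exponent p} (h : b e ≠ 0) (s : ℝ) :
    -Real.log (termNorm b (Real.exp s) e) = -Real.log ‖b e‖ - s * ((e.val : ℚ) : ℝ) := by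
  rw [termNorm, Real.log_mul (norm_ne_zero_iff.mpr h) (by positivity),
    Real.log_rpow (Real.exp_pos s), Real.log_exp]
  ring

theorem ne_zero_of_termNorm_pos {b : Exponent p → F} {R : ℝ} {e : Exponent p}
    (h : 0 < termNorm b R e) : b e ≠ 0 := fun h0 => by
  rw [termNorm, h0, norm_zero, zero_mul] at h
  exact h.false

/-- A convex set containing the Newton points that meets the supporting line only above `[u, v]`. -/
theorem convex_half_plane_union_segment (s m u v : ℝ) :
    Convex ℝ {P : ℝ × ℝ | m < P.2 - s * P.1 ∨ (P.2 - s * P.1 = m ∧ P.1 ∈ Set.Icc u v)} := by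
  intro P hP Q hQ a b ha hb hab
  rcases ha.eq_or_lt with rfl | ha
  · obtain rfl : b = 1 := by linarith
    simpa using hQ
  rcases hb.eq_or_lt with rfl | hb
  · obtain rfl : a = 1 := by linarith
    simpa using hP
  have hL : (a • P + b • Q).2 - s * (a • P + b • Q).1 =
      a * (P.2 - s * P.1) + b * (Q.2 - s * Q.1) := by
    simp only [Prod.snd_add, Prod.smul_snd, Prod.fst_add, Prod.smul_fst, smul_eq_mul]
    ring
  have hm : m = a * m + b * m := by rw [← add_mul, hab, one_mul]
  simp only [Set.mem_ofPred_eq]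
  rw [hL]
  rcases hP with hP | ⟨hP, hP'⟩ <;> rcases hQ with hQ | ⟨hQ, hQ'⟩
  · left
    nlinarith [mul_lt_mul_of_pos_left hP ha, mul_lt_mul_of_pos_left hQ hb]
  · left
    nlinarith [mul_lt_mul_of_pos_left hP ha]
  · left
    nlinarith [mul_lt_mul_of_pos_left hQ hb]
  · right
    exact ⟨by rw [hP, hQ, ← hm], convex_Icc u v hP' hQ' ha.le hb.le hab⟩

/-- The functional `P.2 - s * P.1` at the point of `e` is minus the logarithm of the term at radius
`exp s`. Contact with the line of slope `s` thus means maximal term. -/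
theorem segmentLength_eq {b : Exponent p → F} {s : ℝ} {e₀ e₁ : Exponent p}
    (h₀ : IsLastMax b (Real.exp s) e₀) (h₁ : IsFirstMax b (Real.exp s) e₁) :
    segmentLength p b s = ENNReal.ofReal (((e₀.val : ℚ) : ℝ) - ((e₁.val : ℚ) : ℝ)) := by
  set R := Real.exp s with hR
  set m : ℝ := -Real.log (termNorm b R e₀) with hm
  have h01 : termNorm b R e₁ = termNorm b R e₀ := le_antisymm (h₀.le e₁) (h₁.le e₀)
  let pt : Exponent p → ℝ × ℝ := fun e => (((e.val : ℚ) : ℝ), -Real.log ‖b e‖)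
  have hpt : ∀ e, b e ≠ 0 → pt e ∈ newtonPoints p b := fun e he =>
    ⟨e, rfl, valuation_eq_coe_iff.mpr ⟨he, rfl⟩⟩
  have hLpt : ∀ e, b e ≠ 0 → (pt e).2 - s * (pt e).1 = -Real.log (termNorm b R e) := fun e he =>
    (neg_log_termNorm he s).symm
  have hhull : convexHull ℝ (newtonPoints p b) ⊆ {P : ℝ × ℝ | m < P.2 - s * P.1 ∨
      (P.2 - s * P.1 = m ∧ P.1 ∈ Set.Icc ((e₁.val : ℚ) : ℝ) ((e₀.val : ℚ) : ℝ))} := by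
    refine convexHull_min ?_ (convex_half_plane_union_segment s m _ _)
    rintro ⟨x, y⟩ ⟨e, rfl, he⟩
    obtain ⟨hbe, rfl⟩ := valuation_eq_coe_iff.mp he
    have hpos : 0 < termNorm b R e := mul_pos (norm_pos_iff.mpr hbe) (by positivity)
    have hL := hLpt e hbe
    simp only [pt] at hL
    simp only [Set.mem_ofPred_eq]
    rw [hL]
    rcases (h₀.le e).lt_or_eq with hlt | heq
    · exact Or.inl (neg_lt_neg (Real.log_lt_log hpos hlt))
    · refine Or.inr ⟨by rw [heq], ?_, ?_⟩
      · by_contra! hlt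
        have := h₁.lt e (by exact_mod_cast hlt)
        rw [h01, heq] at this
        exact this.false
      · by_contra! hlt
        exact (h₀.lt e (by exact_mod_cast hlt)).ne heq
  have hge : ∀ P ∈ convexHull ℝ (newtonPoints p b), m ≤ P.2 - s * P.1 := fun P hP => by
    rcases hhull hP with h | h
    · exact h.le
    · exact h.1.ge
  have hpoly : ∀ e, b e ≠ 0 → termNorm b R e = termNorm b R e₀ → pt e ∈ newtonPolygon p b := by
    intro e hbe heq
    refine ⟨subset_convexHull ℝ _ (hpt e hbe), fun y hy => ?_⟩
    have h1 := hge _ hy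
    have h2 := hLpt e hbe
    rw [heq] at h2
    simp only at h1
    linarith
  have hseg : ∀ e, b e ≠ 0 → termNorm b R e = termNorm b R e₀ → pt e ∈ newtonSegment p b s := by
    intro e hbe heq
    refine ⟨hpoly e hbe heq, fun P hP => ?_⟩
    rw [hLpt e hbe, heq]
    exact hge P hP.1
  have hb₀ := ne_zero_of_termNorm_pos h₀.pos
  have hb₁ := ne_zero_of_termNorm_pos h₁.pos
  have hle : ((e₁.val : ℚ) : ℝ) ≤ ((e₀.val : ℚ) : ℝ) := by
    by_contra! hlt
    exact (h₀.lt e₁ (by exact_mod_cast hlt)).ne h01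
  rw [segmentLength]
  apply le_antisymm
  · rw [← Real.ediam_Icc]
    refine Metric.ediam_mono ?_
    rintro _ ⟨P, hP, rfl⟩
    have h1 := hP.2 _ (hpoly e₀ hb₀ rfl)
    rw [hLpt e₀ hb₀] at h1
    rcases hhull hP.1.1 with h | h
    · exact absurd h1 (not_le.mpr h)
    · exact h.2
  · have h1 := Metric.edist_le_ediam_of_mem (Set.mem_image_of_mem Prod.fst (hseg e₀ hb₀ rfl))
      (Set.mem_image_of_mem Prod.fst (hseg e₁ hb₁ h01))
    rwa [edist_dist, Real.dist_eq, abs_of_nonneg (sub_nonneg.mpr hle)] at h1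

variable [CharP F p] [PerfectRing F p] [IsUltrametricDist F]

theorem tendsto_termNorm_radius (b : Exponent p → F) (e : Exponent p) {R : ℝ} (hR : 0 < R) :
    Tendsto (fun ρ => termNorm b ρ e) (𝓝[<] R) (𝓝 (termNorm b R e)) :=
  ((Real.continuousAt_rpow_const R _ (Or.inl hR.ne')).tendsto.const_mul ‖b e‖).mono_left
    nhdsWithin_le_nhds

/-- Reducing the radius shrinks terms of larger exponent faster, which breaks ties in favour of
`e₁`. Among smaller exponents only finitely many terms are near maximal, and continuity keeps these
below; the others stay under half the maximum. -/
theorem IsFirstMax.eventually_isLastMax {b : Exponent p → F} (hb : b ∈ seriesP p F) {R : ℝ}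
    (hR : 0 < R) {e₁ : Exponent p} (h : IsFirstMax b R e₁) :
    ∀ᶠ ρ in 𝓝[<] R, 0 < ρ ∧ IsLastMax b ρ e₁ := by
  have hpos := h.pos
  have ht := tendsto_termNorm_radius b e₁ hR
  have hE := finite_le_termNorm hb hR.le (half_pos hpos)
  have h1 : ∀ᶠ ρ in 𝓝[<] R, termNorm b R e₁ / 2 < termNorm b ρ e₁ :=
    ht.eventually (lt_mem_nhds (half_lt_self hpos))
  have h2 : ∀ᶠ ρ in 𝓝[<] R, ∀ e ∈ {e | termNorm b R e₁ / 2 ≤ termNorm b R e},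
      e.val < e₁.val → termNorm b ρ e < termNorm b ρ e₁ := by
    rw [Filter.eventually_all_finite hE]
    intro e _
    by_cases he : e.val < e₁.val
    · filter_upwards [(tendsto_termNorm_radius b e hR).eventually_lt ht (h.lt e he)] with ρ hρ _
      exact hρ
    · exact Eventually.of_forall fun ρ he' => absurd he' he
  filter_upwards [h1, h2, Ioo_mem_nhdsLT hR] with ρ hρ1 hρ2 hρ
  have hgt : ∀ e, e₁.val < e.val → termNorm b ρ e < termNorm b ρ e₁ := fun e he => by
    have hq : 0 < ρ / R := div_pos hρ.1 hR
    have hscale : ∀ e : Exponent p,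
        termNorm b ρ e = termNorm b R e * (ρ / R) ^ ((e.val : ℚ) : ℝ) := fun e => by
      rw [termNorm, termNorm, mul_assoc, ← Real.mul_rpow hR.le hq.le, mul_div_cancel₀ _ hR.ne']
    rw [hscale e, hscale e₁]
    calc termNorm b R e * (ρ / R) ^ ((e.val : ℚ) : ℝ)
        ≤ termNorm b R e₁ * (ρ / R) ^ ((e.val : ℚ) : ℝ) := by
          gcongr
          exact h.le e
      _ < termNorm b R e₁ * (ρ / R) ^ ((e₁.val : ℚ) : ℝ) := by
          gcongr 1
          exact Real.rpow_lt_rpow_of_exponent_gt hq ((div_lt_one hR).mpr hρ.2)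
            (by exact_mod_cast he)
  have hlt : ∀ e, e.val < e₁.val → termNorm b ρ e < termNorm b ρ e₁ := fun e he => by
    by_cases heE : termNorm b R e₁ / 2 ≤ termNorm b R e
    · exact hρ2 e heE he
    · exact ((termNorm_mono b hρ.1.le hρ.2.le e).trans_lt (not_le.mp heE)).trans hρ1
  refine ⟨hρ.1, (half_pos hpos).trans hρ1, fun e => ?_, hgt⟩
  rcases lt_trichotomy e.val e₁.val with he | he | he
  · exact (hlt e he).le
  · rw [Exponent.ext he]
  · exact (hgt e he).le

variable [CompleteSpace F] [IsAlgClosed F] [MeasurableSpace F] [BorelSpace F]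

theorem measure_norm_lt {b : Exponent p → F} (hb : b ∈ seriesP p F) {X : Set F} {μ : Measure X}
    (hμ : ∀ (α : F) (r : ℝ) (N : ℝ≥0∞), 0 < r → HasCount b α r N →
      μ {z | (z : F) ∈ Metric.closedBall α r} = N) {R : ℝ} (hR : 0 < R) {e₁ : Exponent p}
    (h : IsFirstMax b R e₁) : μ {z | ‖(z : F)‖ < R} = ENNReal.ofReal (e₁.val : ℝ) := by
  obtain ⟨ρ₀, hρ₀, hev⟩ := (mem_nhdsLT_iff_exists_Ioo_subset' hR).mp (h.eventually_isLastMax hb hR)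
  obtain ⟨u, hu, hmem, hlim⟩ := exists_seq_strictMono_tendsto' (Set.mem_Iio.mp hρ₀)
  have hU : {z : X | ‖(z : F)‖ < R} = ⋃ n, {z : X | (z : F) ∈ Metric.closedBall 0 (u n)} := by
    ext z
    simp only [Set.mem_ofPred_eq, Set.mem_iUnion, mem_closedBall_zero_iff]
    constructor
    · intro hz
      obtain ⟨n, hn⟩ := (hlim.eventually (lt_mem_nhds hz)).exists
      exact ⟨n, hn.le⟩
    · rintro ⟨n, hn⟩
      exact hn.trans_lt (hmem n).2
  have hmono : Monotone fun n => {z : X | (z : F) ∈ Metric.closedBall 0 (u n)} :=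
    fun i j hij z hz => Metric.closedBall_subset_closedBall (hu.monotone hij) hz
  rw [hU, hmono.measure_iUnion]
  have hn : ∀ n, μ {z : X | (z : F) ∈ Metric.closedBall 0 (u n)} =
      ENNReal.ofReal (e₁.val : ℝ) := fun n => by
    obtain ⟨h1, h2⟩ := hev (hmem n)
    exact hμ 0 (u n) _ h1 (h2.hasCount h1)
  simp only [hn, ciSup_const]

/-- The circle is the closed disc minus the open one, of masses `e₀` and `e₁`. -/
theorem segmentLength_eq_measure {b : Exponent p → F} (hb : b ∈ seriesP p F) (h0 : b ≠ 0)
    {X : Set F} {μ : Measure X}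
    (hμ : ∀ (α : F) (r : ℝ) (N : ℝ≥0∞), 0 < r → HasCount b α r N →
      μ {z | (z : F) ∈ Metric.closedBall α r} = N) (s : ℝ) :
    segmentLength p b s = μ {z | valuation (z : F) = ((-s : ℝ) : EReal)} := by
  have hR := Real.exp_pos s
  obtain ⟨e₀, he₀⟩ := exists_isLastMax hb h0 hR
  obtain ⟨e₁, he₁⟩ := exists_isFirstMax hb h0 hR
  have hset : {z : X | valuation (z : F) = ((-s : ℝ) : EReal)} =
      {z : X | (z : F) ∈ Metric.closedBall 0 (Real.exp s)} \ {z : X | ‖(z : F)‖ < Real.exp s} := by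
    ext z
    simp only [Set.mem_ofPred_eq, Set.mem_sdiff, mem_closedBall_zero_iff, not_lt,
      valuation_eq_coe_iff, neg_inj]
    rw [← le_antisymm_iff]
    constructor
    · rintro ⟨hz, rfl⟩
      rw [Real.exp_log (norm_pos_iff.mpr hz)]
    · intro hz
      exact ⟨norm_pos_iff.mp (hz ▸ hR), by rw [hz, Real.log_exp]⟩
  have hlt := measure_norm_lt hb hμ hR he₁
  rw [segmentLength_eq he₀ he₁, hset, measure_sdiff, hμ 0 _ _ hR (he₀.hasCount hR), hlt,
    ENNReal.ofReal_sub _ e₁.val_cast_nonneg]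
  · intro z hz
    exact mem_closedBall_zero_iff.mpr (le_of_lt hz)
  · have : MeasurableSet {z : X | ‖(z : F)‖ < Real.exp s} :=
      measurableSet_lt (measurable_subtype_coe.norm) measurable_const
    exact this.nullMeasurableSet
  · rw [hlt]
    exact ENNReal.ofReal_ne_top

/-- Exponents below `e` whose term at radius `1` is at least that of `e` are finite in number and
are overtaken by growth; any other smaller exponent starts lower and grows no faster. -/
theorem exists_forall_le_isLastMax {b : Exponent p → F} (hb : b ∈ seriesP p F) {e : Exponent p}
    (he : b e ≠ 0) : ∀ᶠ R in atTop, ∀ e₀, IsLastMax b R e₀ → e.val ≤ e₀.val := by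
  have hpos : 0 < termNorm b 1 e := mul_pos (norm_pos_iff.mpr he) (by positivity)
  have h1 : ∀ᶠ R in atTop, ∀ e' ∈ {e' | termNorm b 1 e ≤ termNorm b 1 e'},
      e'.val < e.val → termNorm b R e' < termNorm b R e := by
    rw [Filter.eventually_all_finite (finite_le_termNorm hb zero_le_one hpos)]
    intro e' _
    by_cases hlt : e'.val < e.val
    · have hd : (0 : ℝ) < ((e.val : ℚ) : ℝ) - ((e'.val : ℚ) : ℝ) := by
        rw [sub_pos]
        exact_mod_cast hlt
      have h2 := (tendsto_rpow_atTop hd).eventually (eventually_gt_atTop (‖b e'‖ / ‖b e‖))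
      filter_upwards [h2, eventually_gt_atTop 0] with R hR hR0 _
      rw [div_lt_iff₀ (norm_pos_iff.mpr he), Real.rpow_sub hR0, div_mul_eq_mul_div,
        lt_div_iff₀ (by positivity)] at hR
      rw [termNorm, termNorm, mul_comm ‖b e‖]
      exact hR
    · exact Eventually.of_forall fun R h' => absurd h' hlt
  filter_upwards [h1, eventually_ge_atTop 1] with R hR hR1 e₀ he₀
  by_contra! hlt
  have hscale : ∀ e : Exponent p, termNorm b R e = termNorm b 1 e * R ^ ((e.val : ℚ) : ℝ) :=
    fun e => by rw [termNorm, termNorm, Real.one_rpow, mul_one]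
  by_cases hmem : termNorm b 1 e ≤ termNorm b 1 e₀
  · exact (hR e₀ hmem hlt).not_ge (he₀.le e)
  · refine absurd (he₀.le e) (not_le.mpr ?_)
    have hR0 : 0 < R := zero_lt_one.trans_le hR1
    rw [hscale, hscale]
    calc _ < termNorm b 1 e * R ^ ((e₀.val : ℚ) : ℝ) := by
          gcongr 1
          exact not_le.mp hmem
      _ ≤ _ := by
          gcongr 1
          exact Real.rpow_le_rpow_of_exponent_le hR1 (by exact_mod_cast hlt.le)

theorem measure_univ_eq_iSup {b : Exponent p → F} (hb : b ∈ seriesP p F) (h0 : b ≠ 0)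
    {X : Set F} {μ : Measure X}
    (hμ : ∀ (α : F) (r : ℝ) (N : ℝ≥0∞), 0 < r → HasCount b α r N →
      μ {z | (z : F) ∈ Metric.closedBall α r} = N) :
    μ Set.univ = ⨆ (e : Exponent p) (_ : b e ≠ 0), ENNReal.ofReal (e.val : ℝ) := by
  have hU : (Set.univ : Set X) = ⋃ n : ℕ, {z : X | (z : F) ∈ Metric.closedBall 0 ((n : ℝ) + 1)} := by
    refine (Set.eq_univ_of_forall fun z => ?_).symm
    obtain ⟨n, hn⟩ := exists_nat_ge ‖(z : F)‖
    exact Set.mem_iUnion.mpr ⟨n, mem_closedBall_zero_iff.mpr (by linarith)⟩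
  have hmono : Monotone fun n : ℕ => {z : X | (z : F) ∈ Metric.closedBall 0 ((n : ℝ) + 1)} :=
    fun i j hij z hz => Metric.closedBall_subset_closedBall (by gcongr) hz
  have hmax : ∀ n : ℕ, ∃ e₀, IsLastMax b ((n : ℝ) + 1) e₀ ∧
      μ {z : X | (z : F) ∈ Metric.closedBall 0 ((n : ℝ) + 1)} = ENNReal.ofReal (e₀.val : ℝ) := by
    intro n
    have hn : (0 : ℝ) < (n : ℝ) + 1 := by positivity
    obtain ⟨e₀, he₀⟩ := exists_isLastMax hb h0 hn
    exact ⟨e₀, he₀, hμ 0 _ _ hn (he₀.hasCount hn)⟩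
  rw [hU, hmono.measure_iUnion]
  apply le_antisymm
  · refine iSup_le fun n => ?_
    obtain ⟨e₀, he₀, hn⟩ := hmax n
    rw [hn]
    exact le_iSup₂_of_le e₀ (ne_zero_of_termNorm_pos he₀.pos) le_rfl
  · refine iSup₂_le fun e he => ?_
    have h1 : Tendsto (fun n : ℕ => (n : ℝ) + 1) atTop atTop :=
      tendsto_atTop_add_const_right _ _ tendsto_natCast_atTop_atTop
    obtain ⟨n, hn⟩ := (h1.eventually (exists_forall_le_isLastMax hb he)).exists
    obtain ⟨e₀, he₀, hμn⟩ := hmax n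
    refine le_iSup_of_le n ?_
    rw [hμn]
    exact ENNReal.ofReal_le_ofReal (by exact_mod_cast hn e₀ he₀)

/-- Only exponent `0` is affected, and it contributes `0` to the supremum. -/
theorem iSup_sub_const (a : Exponent p → F) (c : F) :
    ⨆ (e : Exponent p) (_ : (a - const p c) e ≠ 0), ENNReal.ofReal (e.val : ℝ) =
      ⨆ (e : Exponent p) (_ : a e ≠ 0), ENNReal.ofReal (e.val : ℝ) := by
  have key : ∀ (f g : Exponent p → F), (∀ e : Exponent p, e.val ≠ 0 → f e = g e) →
      ⨆ (e : Exponent p) (_ : f e ≠ 0), ENNReal.ofReal (e.val : ℝ) ≤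
        ⨆ (e : Exponent p) (_ : g e ≠ 0), ENNReal.ofReal (e.val : ℝ) := fun f g hfg => by
    refine iSup₂_le fun e he => ?_
    by_cases h : e.val = 0
    · simp [h]
    · exact le_iSup₂_of_le e (hfg e h ▸ he) le_rfl
  have h : ∀ e : Exponent p, e.val ≠ 0 → (a - const p c) e = a e := fun e he => by
    rw [Pi.sub_apply, const, if_neg he, sub_zero]
  exact le_antisymm (key _ _ h) (key _ _ fun e he => (h e he).symm)

end Newton

/-! ### Linear series and Haar measure -/

section

open Polynomial

section Haar

variable {p : ℕ} [hp : Fact p.Prime] {F : Type*} [NormedField F] [CharP F p] [PerfectRing F p]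

theorem exists_natCast_pow_eq_of_mem_seriesF {k : ℕ} {a : Exponent p → F} (ha : a ∈ seriesF p k F)
    {e : Exponent p} (he : a e ≠ 0) {n j : ℕ} (hj : e.val * (p : ℚ) ^ n = j) :
    ∃ i : ℕ, j = p ^ i := by
  have hp0 : (p : ℚ) ≠ 0 := by exact_mod_cast hp.out.ne_zero
  have hp1 : (1 : ℚ) < p := by exact_mod_cast hp.out.one_lt
  obtain ⟨m, hm⟩ := ha.2 e he
  have h1 : (j : ℚ) = (p : ℚ) ^ ((k : ℤ) * m + n) := by
    rw [← hj, hm, zpow_add₀ hp0, zpow_mul, zpow_natCast, zpow_natCast]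
  have h2 : 0 ≤ (k : ℤ) * m + n := by
    by_contra! hneg
    have h3 : (p : ℚ) ^ ((k : ℤ) * m + n) < 1 := zpow_lt_one_of_neg₀ hp1 hneg
    have h4 : 0 < (p : ℚ) ^ ((k : ℤ) * m + n) := by positivity
    rw [← h1] at h3 h4
    have h5 : j < 1 := by exact_mod_cast h3
    have h6 : 0 < j := by exact_mod_cast h4
    omega
  obtain ⟨i, hi⟩ := Int.eq_ofNat_of_zero_le h2
  refine ⟨i, ?_⟩
  rw [hi, zpow_natCast] at h1
  exact_mod_cast h1

/-- Monomials of `Q` at exponents where `a` vanishes are pure error and can be dropped; the others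
have degree a power of `p`, hence are additive. -/
theorem Approx.exists_additive {k : ℕ} {a : Exponent p → F} (ha : a ∈ seriesF p k F) {R ε : ℝ}
    (hε : 0 ≤ ε) {n : ℕ} {Q : F[X]} (h : Approx a R ε n Q) :
    ∃ Q' : F[X], Approx a R ε n Q' ∧ ∀ x : F, taylor x Q' = Q' + C (Q'.eval x) := by
  classical
  set S : Finset ℕ := Q.support.filter fun j => a ((Exponent.ofNat p j).divPow n) ≠ 0 with hS
  set Q' : F[X] := ∑ j ∈ S, monomial j (Q.coeff j) with hQ'
  refine ⟨Q', ⟨fun e j hj => ?_, h.termNorm_le⟩, fun x => ?_⟩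
  · have hc : Q'.coeff j = if j ∈ S then Q.coeff j else 0 := by
      rw [hQ', finsetSum_coeff]
      simp only [coeff_monomial, Finset.sum_ite_eq']
    by_cases hae : a e = 0
    · have hjS : j ∉ S := by
        rw [hS, Finset.mem_filter, ← Exponent.eq_ofNat_divPow hj]
        exact fun h => h.2 hae
      rw [hc, if_neg hjS, hae, zero_pow (pow_ne_zero n hp.out.ne_zero), sub_zero, norm_zero,
        zero_mul]
      positivity
    · have hcQ : Q'.coeff j = Q.coeff j := by
        rw [hc]
        split_ifs with hjS
        · rfl
        · by_contra hne
          refine hjS (Finset.mem_filter.mpr ⟨mem_support_iff.mpr (Ne.symm hne), ?_⟩)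
          rwa [← Exponent.eq_ofNat_divPow hj]
      rw [hcQ]
      exact h.coeff_le e j hj
  · rw [hQ', map_sum, eval_finsetSum, map_sum, ← Finset.sum_add_distrib]
    refine Finset.sum_congr rfl fun j hj => ?_
    obtain ⟨i, rfl⟩ := exists_natCast_pow_eq_of_mem_seriesF ha (Finset.mem_filter.mp hj).2
      (Exponent.val_ofNat_divPow_mul j n)
    rw [taylor_monomial, add_pow_char_pow, mul_add, ← C_pow, ← C_mul, C_mul_X_pow_eq_monomial,
      eval_monomial]

variable [IsUltrametricDist F] [CompleteSpace F] [IsAlgClosed F]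

theorem rootCount_taylor {Q : F[X]} (hQ : Q ≠ 0) (x α : F) {r : ℝ} (hr : 0 < r) :
    rootCount (taylor x Q) α r = rootCount Q (α + x) r := by
  have h1 := isDominant_taylor ((taylor_eq_zero x Q).not.mpr hQ) α hr
  rw [taylor_taylor] at h1
  exact (h1.unique (isDominant_taylor hQ (α + x) hr)).2

/-- For an additive approximation `Q`, translating by a zero `x` adds the constant `Q.eval x`, which
is within the approximation error and so does not change the count. -/
theorem HasCount.add_right {k : ℕ} {a : Exponent p → F} (ha : a ∈ seriesF p k F) (h0 : a ≠ 0)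
    {α x : F} {r : ℝ} {N : ℝ≥0∞} (hr : 0 < r) (hx : eval p a x = 0) (h : HasCount a α r N) :
    HasCount a (α + x) r N := by
  obtain ⟨N', h'⟩ := exists_hasCount ha.1 h0 (α + x) hr
  obtain ⟨R₁, ε₁, hR₁, hε₁, H₁⟩ := h.forall_approx
  obtain ⟨R₂, ε₂, hR₂, hε₂, H₂⟩ := h'.forall_approx
  obtain ⟨R, hRR₁, hRR₂, hRr, hRα, hRx⟩ :
      ∃ R : ℝ, R₁ ≤ R ∧ R₂ ≤ R ∧ r ≤ R ∧ ‖α‖ ≤ R ∧ ‖x‖ ≤ R := by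
    have := (eventually_ge_atTop R₁).and ((eventually_ge_atTop R₂).and
      ((eventually_ge_atTop r).and ((eventually_ge_atTop ‖α‖).and (eventually_ge_atTop ‖x‖))))
    exact this.exists
  obtain ⟨l, hl, Hl⟩ := exists_discNorm_lower_bound ha.1 h0 hr hRr
  have hε : 0 < min (min ε₁ ε₂) (l / 2) := by positivity
  have hεl : min (min ε₁ ε₂) (l / 2) < l := (min_le_right _ _).trans_lt (half_lt_self hl)
  obtain ⟨n, Q₀, hQ₀⟩ := exists_approx ha.1 (hr.le.trans hRr) hε
  obtain ⟨Q, hQ, hadd⟩ := hQ₀.exists_additive ha hε.le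
  obtain ⟨hQ0, hlow⟩ := Hl _ _ _ hε.le hεl hQ
  have hQx : ‖Q.eval x‖ ≤ min (min ε₁ ε₂) (l / 2) ^ p ^ n := by
    have := hQ.norm_eval_sub_le ha.1 hε.le hRx
    rwa [hx, zero_pow (pow_ne_zero n hp.out.ne_zero), sub_zero] at this
  have hcount : rootCount (taylor x Q) α r = rootCount Q α r := by
    refine rootCount_eq_of_coeff_sub hQ0 hr hRr hRα
      (A := min (min ε₁ ε₂) (l / 2) ^ p ^ n) (fun j => ?_)
      ((pow_lt_pow_left₀ hεl hε.le (pow_ne_zero _ hp.out.ne_zero)).trans_le (hlow α hRα))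
    rw [hadd, sub_add_cancel_left, coeff_neg, norm_neg, coeff_C]
    split_ifs with hj
    · simpa [hj] using hQx
    · rw [norm_zero, zero_mul]
      positivity
  have e1 := H₁ R _ hRR₁ hε.le ((min_le_left _ _).trans (min_le_left _ _)) n Q hQ
  have e2 := H₂ R _ hRR₂ hε.le ((min_le_left _ _).trans (min_le_right _ _)) n Q hQ
  rw [← rootCount_taylor hQ0 x α hr, hcount, e1] at e2
  rwa [e2]

variable [MeasurableSpace F] [BorelSpace F]

/-- Balls determine the measure, so invariance of the counts under translation by zeros gives
invariance of the measure; balls around zeros have finite positive mass. -/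
theorem isAddHaarMeasure_of_hasCount {k : ℕ} {a : Exponent p → F} (ha : a ∈ seriesF p k F)
    (h0 : a ≠ 0) {G : AddSubgroup F} (hG : ∀ z, z ∈ G ↔ eval p a z = 0) {ν : Measure G}
    (hν : ∀ (α : F) (r : ℝ) (N : ℝ≥0∞), 0 < r → HasCount a α r N →
      ν {z | (z : F) ∈ Metric.closedBall α r} = N) : ν.IsAddHaarMeasure := by
  have hprop : ProperSpace G := properSpace_zeros (X := (G : Set F)) ha.1 h0 hG
  have hball : ∀ (x : G) (r : ℝ) (N : ℝ≥0∞), 0 < r → HasCount a (x : F) r N →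
      ν (Metric.closedBall x r) = N := fun x => hν x
  have hfin : ∀ (x : G) (r : ℝ), 0 < r → ν (Metric.closedBall x r) ≠ ⊤ := fun x r hr => by
    obtain ⟨N, hN⟩ := exists_hasCount ha.1 h0 (x : F) hr
    rw [hball x r N hr hN]
    exact hN.ne_top ha.1
  refine { lt_top_of_isCompact := fun K hK => ?_, map_add_left_eq_self := fun g => ?_,
           open_pos := fun U hU hne => ?_ }
  · obtain ⟨r, hr, hKr⟩ := hK.isBounded.subset_closedBall_lt 0 0
    exact (measure_mono hKr).trans_lt (hfin 0 r hr).lt_top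
  · refine (measure_ext_of_closedBall hfin fun x r hr => ?_).symm
    rw [Measure.map_apply (measurable_const_add g) measurableSet_closedBall]
    have hpre : (g + ·) ⁻¹' Metric.closedBall x r = Metric.closedBall (x - g) r := by
      ext y
      rw [Set.mem_preimage, Metric.mem_closedBall, Metric.mem_closedBall, dist_eq_norm,
        dist_eq_norm]
      congr! 2
      abel
    obtain ⟨N, hN⟩ := exists_hasCount ha.1 h0 (x : F) hr
    rw [hpre, hball x r N hr hN, hball (x - g) r N hr]
    have hg : eval p a (-(g : F)) = 0 := (hG _).mp (G.neg_mem g.2)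
    have := hN.add_right ha h0 hr hg
    rwa [← sub_eq_add_neg] at this
  · obtain ⟨x, hx⟩ := hne
    obtain ⟨r, hr, hrU⟩ := Metric.nhds_basis_closedBall.mem_iff.mp (hU.mem_nhds hx)
    obtain ⟨N, hN⟩ := exists_hasCount ha.1 h0 (x : F) hr
    have h1 := measure_mono (μ := ν) hrU
    rw [hball x r N hr hN] at h1
    exact ((pos_iff_ne_zero.mpr (hN.ne_zero ha.1 h0 ((hG _).mp x.2) hr)).trans_le h1).ne'

end Haar

end

theorem sub_const_zero {p : ℕ} {F : Type*} [NormedField F] (a : Exponent p → F) :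
    a - const p 0 = a := by
  funext e
  simp [const]

end FracSeries

end

/-! ### Assembly -/

theorem mainTheorem4 {p : ℕ} [Fact p.Prime] {k : ℕ} (hk : 1 ≤ k)
    {C : Type*} [NormedField C] [IsUltrametricDist C] [CompleteSpace C] [IsAlgClosed C]
    [CharP C p] [MeasurableSpace C] [BorelSpace C]
    (a : FracSeries.Exponent p → C) (ha : a ∈ FracSeries.seriesP p C)
    (hconst : ¬ FracSeries.IsConstant p a) (c : C) :
    ∃ μ : Measure (FracSeries.fiber p a c),
      -- the defining limit on discs, for every centre and every radius
      (∀ (α : C) (r : ℝ), 0 < r →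
        Tendsto
          (fun n : ℕ =>
            FracSeries.numZeros
              (FracSeries.toPowerSeries p
                (FracSeries.frobPow p n (FracSeries.trunc p n a - FracSeries.const p c)))
              (Metric.closedBall α r) / (p : ℝ≥0∞) ^ n)
          atTop (𝓝 (μ {z | (z : C) ∈ Metric.closedBall α r}))) ∧
      -- which characterizes the measure
      (∀ ν : Measure (FracSeries.fiber p a c),
        (∀ (α : C) (r : ℝ), 0 < r →
          Tendsto
            (fun n : ℕ =>
              FracSeries.numZeros
                (FracSeries.toPowerSeries p
                  (FracSeries.frobPow p n (FracSeries.trunc p n a - FracSeries.const p c)))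
                (Metric.closedBall α r) / (p : ℝ≥0∞) ^ n)
            atTop (𝓝 (ν {z | (z : C) ∈ Metric.closedBall α r}))) →
        ν = μ) ∧
      -- the Newton polygon of `f - c`
      (∀ s : ℝ, FracSeries.segmentLength p (a - FracSeries.const p c) s =
        μ {z | FracSeries.valuation (z : C) = ((-s : ℝ) : EReal)}) ∧
      -- the total mass
      μ Set.univ = ⨆ (e : FracSeries.Exponent p) (_ : a e ≠ 0), ENNReal.ofReal (e.val : ℝ) ∧
      -- ordinary power series
      (FracSeries.IsOrdinary p a → ∀ S : Set (FracSeries.fiber p a c),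
        μ S = ∑' z : S, (FracSeries.zeroMultiplicity
          (FracSeries.toPowerSeries p (a - FracSeries.const p c)) ((z : _) : C) : ℝ≥0∞)) ∧
      -- linear series
      (∀ (hF : a ∈ FracSeries.seriesF p k C) (hc : c = 0),
        LocallyCompactSpace (FracSeries.ker a hF) ∧
        (μ.map (FracSeries.fiberToKer hF hc)).IsAddHaarMeasure) := by
  have hb : a - FracSeries.const p c ∈ FracSeries.seriesP p C :=
    FracSeries.sub_mem_seriesP ha (FracSeries.const_mem_seriesP c)
  have h0 := FracSeries.sub_const_ne_zero hconst c
  have hX : ∀ z, z ∈ FracSeries.fiber p a c ↔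
      FracSeries.eval p (a - FracSeries.const p c) z = 0 := fun z => by
    rw [FracSeries.eval_sub_const ha, sub_eq_zero]
    rfl
  have := FracSeries.properSpace_zeros hb h0 hX
  obtain ⟨μ, hμ⟩ := FracSeries.exists_zeroMeasure hb h0 hX
  have hlim : ∀ (α : C) (r : ℝ), 0 < r → Tendsto
      (fun n : ℕ => FracSeries.numZeros (FracSeries.toPowerSeries p
        (FracSeries.frobPow p n (FracSeries.trunc p n a - FracSeries.const p c)))
        (Metric.closedBall α r) / (p : ℝ≥0∞) ^ n) atTop
      (𝓝 (μ {z | (z : C) ∈ Metric.closedBall α r})) := fun α r hr => by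
    obtain ⟨N, hN⟩ := FracSeries.exists_hasCount hb h0 α hr
    rw [hμ α r N hr hN]
    exact FracSeries.tendsto_numZeros ha hconst c hr hN
  refine ⟨μ, hlim, fun ν hν => ?_, FracSeries.segmentLength_eq_measure hb h0 hμ, ?_,
    fun hord S => ?_, fun hF hc => ?_⟩
  -- Limits are unique, so both measures agree on balls centred in the fibre, and these balls have
  -- finite mass.
  · refine (FracSeries.measure_ext_of_closedBall (fun x r hr => ?_) fun x r hr => ?_).symm
    · obtain ⟨N, hN⟩ := FracSeries.exists_hasCount hb h0 (x : C) hr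
      exact (hμ x r N hr hN).trans_ne (hN.ne_top hb)
    · exact tendsto_nhds_unique (hlim x r hr) (hν x r hr)
  · rw [FracSeries.measure_univ_eq_iSup hb h0 hμ, FracSeries.iSup_sub_const]
  · refine FracSeries.zeroMeasure_eq_tsum hb h0 (fun e he => ?_) hX hμ S
    by_cases h : e.val = 0
    · exact ⟨0, by simpa using h⟩
    · refine hord e ?_
      rwa [Pi.sub_apply, FracSeries.const, if_neg h, sub_zero] at he
  · subst hc
    rw [FracSeries.sub_const_zero] at h0 hX hμ
    have hG : ∀ z, z ∈ FracSeries.ker a hF ↔ FracSeries.eval p a z = 0 := fun z =>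
      AddMonoidHom.mem_ker
    have hmeas : Measurable (FracSeries.fiberToKer hF rfl) :=
      measurable_subtype_coe.subtype_mk
    have hproper : ProperSpace (FracSeries.ker a hF) :=
      FracSeries.properSpace_zeros (X := (FracSeries.ker a hF : Set C)) ha h0 hG
    refine ⟨inferInstance, FracSeries.isAddHaarMeasure_of_hasCount hF h0 hG fun α r N hr hN => ?_⟩
    exact (Measure.map_apply hmeas (measurable_subtype_coe measurableSet_closedBall)).trans
      (hμ α r N hr hN)
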